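/- Let $k$ be a commutative unitary ring and let all algebras be commutative and unitary over $k$; $\otimes=\otimes_k$. A *left counital bialgebra* $(H,m,1_H,\Delta,\varepsilon)$ is an algebra with algebra homomorphisms $\Delta:H\to H\otimes H$ and $\varepsilon:H\to k$ such that $\Delta$ is coassociative and $(\varepsilon\otimes\mathrm{id})\Delta(x)=1\otimes x$ for all $x$. It is *filtered* by submodules $H^0\subseteq H^1\subseteq\cdots$ if $\bigcup_n H^n=H$, $H^pH^q\subseteq H^{p+q}$ and $$\Delta(H^n)\subseteq H^0\otimes H^n+\sum_{p+q=n,\;p,q>0}H^p\otimes H^q ,$$ where $H^p\otimes H^q$ denotes the image in $H\otimes H$; it is *connected* if moreover $H^0=k1_H$. A *right antipode* is a linear map $S:H\to H$ with $m(\mathrm{id}\otimes S)\Delta(x)=\varepsilon(x)1_H$ for all $x$, and a left counital bialgebra with a right antipode is a *left counital Hopf algebra*. For $\lambda\in k$, a *$\lambda$-TD algebra* is an algebra $R$ with a linear operator $P$ such that $P(x)P(y)=P\big(xP(y)+P(x)y+\lambda xy-xP(1)y\big)$ for all $x,y\in R$. Let $A$ be a left counital bialgebra with coproduct $\Delta_A$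 and left counit $\varepsilon_A$, filtered and connected by $(A^n)_{n\ge0}$, and let $\lambda\in k$. On $\bigoplus_{n\ge0}A^{\otimes n}$ let $ш_\lambda$ be the bilinear product for which $1_k$ is a two-sided unit and $$(a\otimes\mathfrak a')\,ш_\lambda\,(b\otimes\mathfrak b')=a\otimes\big(\mathfrak a' ш_\lambda (b\otimes\mathfrak b')\big)+b\otimes\big((a\otimes\mathfrak a') ш_\lambda \mathfrak b'\big)+\lambda\, ab\otimes(\mathfrak a' ш_\lambda \mathfrak b')-ab\otimes\big((\mathfrak a' ш_\lambda 1_A) ш_\lambda \mathfrak b'\big).$$ Let $Ш(A)=A\otimes\bigoplus_{n\ge0}A^{\otimes n}\cong\bigoplus_{n\ge1}A^{\otimes n}$, with product $(a\otimes\mathfrak a')\diamond(b\otimes\mathfrak b')=ab\otimes(\mathfrak a' ш_\lambda\mathfrak b')$, unit $1_A$, operator $P(\mathfrak a)=1_A\otimes\mathfrak a$, and $j_A:A\to Ш(A)$ the natural embedding. Define linear maps $\Delta:Ш(A)\to Ш(A)\otimesШ(A)$ and $\varepsilon:Ш(A)\to k$ by $\Delta(a)=\Delta_A(a)$ for $a\in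 A$ and $\Delta(a_1\otimes\mathfrak a')=\Delta_A(a_1)\cdot\big((\mathrm{id}\otimes P)\Delta(\mathfrak a')\big)$ for $\mathfrak a'\in A^{\otimes n}$, $n\ge1$ (with the componentwise product on $Ш(A)\otimesШ(A)$), and by $\varepsilon=\varepsilon_A$ on $A$, $\varepsilon=0$ on $A^{\otimes n}$ for $n\ge2$. For $a\in A$ put $\deg(a)=\min\{n: a\in A^n\}$, and let $Ш(A)^n$ be the linear span of the pure tensors $a_1\otimes\cdots\otimes a_m$ ($m\ge1$) with $\deg(a_1)+\cdots+\deg(a_m)+m-1\le n$. **Theorem.** $(Ш(A),\diamond,P,j_A)$ is the free commutative $\lambda$-TD algebra on $A$: it is a commutative $\lambda$-TD algebra, $j_A$ is an algebra homomorphism, and every algebra homomorphism from $A$ to a commutative $\lambda$-TD algebra $(R,Q)$ factors uniquely through $j_A$ by an algebra homomorphism $g:Ш(A)\to R$ with $gP=Qg$. Moreover $\Delta P=(\mathrm{id}\otimes P)\Delta$; $(Ш(A),\diamond,1_A,\Delta,\varepsilon)$ is a left counital bialgebra, filtered and connected by $(Ш(A)^n)_{n\ge0}$; and it has a right antipode,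 that is, it is a left counital Hopf algebra. -/

import Mathlib

open scoped TensorProduct

noncomputable section

namespace TDHopf

/-! ### Left counital (operated) bialgebras

The structure maps are given as bare linear maps on a `k`-module `H`; the laws are predicates. -/

section General

variable {k H : Type*} [CommRing k] [AddCommGroup H] [Module k H]

/-- `(H, m, one)` is a unitary commutative associative `k`-algebra. -/
structure IsUnitaryCommAlgebra (m : H →ₗ[k] H →ₗ[k] H) (one : H) : Prop where
  assoc : ∀ x y z, m (m x y) z = m x (m y z)
  comm : ∀ x y, m x y = m y x
  one_mul : ∀ x, m one x = x

/-- `(H, Δ, ε)` is a left counital coalgebra: `Δ` is coassociative and `(ε ⊗ id) Δ x = 1 ⊗ x`. -/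
structure IsLeftCounitalCoalgebra (Δ : H →ₗ[k] H ⊗[k] H) (ε : H →ₗ[k] k) : Prop where
  coassoc : ∀ x, TensorProduct.assoc k H H H (Δ.rTensor H (Δ x)) = Δ.lTensor H (Δ x)
  left_counit : ∀ x, ε.rTensor H (Δ x) = 1 ⊗ₜ[k] x

/-- The componentwise product `(a ⊗ b) • (c ⊗ d) = m a c ⊗ m b d` on `H ⊗ H`. -/
def tensorMul (m : H →ₗ[k] H →ₗ[k] H) :
    H ⊗[k] H →ₗ[k] H ⊗[k] H →ₗ[k] H ⊗[k] H :=
  TensorProduct.map₂ m m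

/-- `(H, m, one, Δ, ε)` is a (commutative) left counital bialgebra: an algebra and a left counital
coalgebra such that `Δ` and `ε` are unitary algebra homomorphisms. -/
structure IsLeftCounitalBialgebra (m : H →ₗ[k] H →ₗ[k] H) (one : H)
    (Δ : H →ₗ[k] H ⊗[k] H) (ε : H →ₗ[k] k) : Prop extends
    IsUnitaryCommAlgebra m one, IsLeftCounitalCoalgebra Δ ε where
  comul_one : Δ one = one ⊗ₜ[k] one
  comul_mul : ∀ x y, Δ (m x y) = tensorMul m (Δ x) (Δ y)
  counit_one : ε one = 1
  counit_mul : ∀ x y, ε (m x y) = ε x * ε y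

/-- The 1-cocycle property `Δ P = (id ⊗ P) Δ`. -/
def IsCocycle (Δ : H →ₗ[k] H ⊗[k] H) (P : H →ₗ[k] H) : Prop :=
  ∀ x, Δ (P x) = P.lTensor H (Δ x)

/-- The `lam`-TD equation
`P(x) P(y) = P(x P(y) + P(x) y + lam x y - x P(1) y)`. -/
def IsTDOperator (lam : k) (m : H →ₗ[k] H →ₗ[k] H) (one : H) (P : H →ₗ[k] H) : Prop :=
  ∀ x y, m (P x) (P y) =
    P (m x (P y) + m (P x) y + lam • m x y - m (m x (P one)) y)

/-- For submodules `U, V ⊆ H`, the image of `U ⊗ V` in `H ⊗ H`. -/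
def tensorSub (U V : Submodule k H) : Submodule k (H ⊗[k] H) :=
  Submodule.map₂ (TensorProduct.mk k H H) U V

/-- `F` is an increasing filtration making the left counital bialgebra `(H, m, one, Δ, ε)`
filtered and connected. -/
structure IsConnectedFiltration (m : H →ₗ[k] H →ₗ[k] H) (one : H) (Δ : H →ₗ[k] H ⊗[k] H)
    (F : ℕ → Submodule k H) : Prop where
  mono : Monotone F
  exhaustive : ∀ x, ∃ n, x ∈ F n
  mul_mem : ∀ p q x y, x ∈ F p → y ∈ F q → m x y ∈ F (p + q)
  comul_mem : ∀ n x, x ∈ F n → Δ x ∈ tensorSub (F 0) (F n) ⊔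
    ⨆ (p : ℕ) (q : ℕ) (_ : p + q = n ∧ 0 < p ∧ 0 < q), tensorSub (F p) (F q)
  connected : F 0 = Submodule.span k {one}

/-- `S` is a right antipode: `id * S = one ∘ ε` for the convolution product
`f * g = m (f ⊗ g) Δ`. -/
def IsRightAntipode (m : H →ₗ[k] H →ₗ[k] H) (one : H) (Δ : H →ₗ[k] H ⊗[k] H) (ε : H →ₗ[k] k)
    (S : H →ₗ[k] H) : Prop :=
  ∀ x, TensorProduct.lift m (S.lTensor H (Δ x)) = ε x • one

/-- A left counital Hopf algebra: a left counital bialgebra having a right antipode. -/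
def IsLeftCounitalHopfAlgebra (m : H →ₗ[k] H →ₗ[k] H) (one : H)
    (Δ : H →ₗ[k] H ⊗[k] H) (ε : H →ₗ[k] k) : Prop :=
  IsLeftCounitalBialgebra m one Δ ε ∧ ∃ S, IsRightAntipode m one Δ ε S

end General

/-! ### The `lam`-TD shuffle product

The module `⨁_{n ≥ 0} A^{⊗ n}` is (the underlying module of) Mathlib's `TensorAlgebra k A`; the pure
tensor `a₁ ⊗ a'` is `ι a₁ * a'`, and `1` spans `A^{⊗ 0} = k`. -/

section Shuffle

variable {k A : Type*} [CommRing k] [CommRing A] [Algebra k A]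

local notation "ι" => TensorAlgebra.ι k (M := A)
local notation "𝕋" => TensorAlgebra k A

/-- The defining recursion of the `lam`-TD shuffle product `S` on `⨁_{n ≥ 0} A^{⊗ n}`. -/
structure IsTDShuffle (lam : k) (S : 𝕋 →ₗ[k] 𝕋 →ₗ[k] 𝕋) : Prop where
  one_left : ∀ y, S 1 y = y
  one_right : ∀ x, S x 1 = x
  cons_cons : ∀ (a b : A) (x y : 𝕋), S (ι a * x) (ι b * y) =
    ι a * S x (ι b * y) + ι b * S (ι a * x) y
      + lam • (ι (a * b) * S x y) - ι (a * b) * S (S x (ι 1)) y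

theorem cons_induction {p : 𝕋 → Prop} (h1 : p 1) (hc : ∀ a x, p x → p (ι a * x))
    (hadd : ∀ x y, p x → p y → p (x + y)) (hsmul : ∀ (c : k) x, p x → p (c • x)) (x : 𝕋) : p x := by
  have key : ∀ y, p y → p (x * y) := by
    refine TensorAlgebra.induction (C := fun x => ∀ y, p y → p (x * y)) ?_ ?_ ?_ ?_ x
    · intro r y hy; rw [← Algebra.smul_def]; exact hsmul r y hy
    · exact fun a y hy => hc a y hy
    · intro u v hu hv y hy; rw [mul_assoc]; exact hu _ (hv _ hy)
    · intro u v hu hv y hy; rw [add_mul]; exact hadd _ _ (hu _ hy) (hv _ hy)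
  simpa using key 1 h1

/-- Right fold: `fold φ m₀ (a₁ ⊗ ⋯ ⊗ aₙ) = φ a₁ (φ a₂ (⋯ (φ aₙ m₀)))`. -/
def fold {M : Type*} [AddCommGroup M] [Module k M] (φ : A →ₗ[k] M →ₗ[k] M) (m₀ : M) : 𝕋 →ₗ[k] M :=
  (LinearMap.applyₗ (R := k) m₀) ∘ₗ
    (TensorAlgebra.lift k (A := Module.End k M) φ).toLinearMap

theorem fold_one {M : Type*} [AddCommGroup M] [Module k M] (φ : A →ₗ[k] M →ₗ[k] M) (m₀ : M) :
    fold φ m₀ 1 = m₀ := by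
  simp [fold]

theorem fold_cons {M : Type*} [AddCommGroup M] [Module k M] (φ : A →ₗ[k] M →ₗ[k] M) (m₀ : M)
    (a : A) (x : 𝕋) : fold φ m₀ (ι a * x) = φ a (fold φ m₀ x) := by
  simp [fold]

/-- The projection onto `A^{⊗ 0} = k`. -/
def proj₀ : 𝕋 →ₗ[k] k := (TensorAlgebra.algebraMapInv (R := k) (M := A)).toLinearMap

theorem proj₀_one : proj₀ (1 : 𝕋) = 1 := by simp [proj₀]

theorem proj₀_cons (a : A) (x : 𝕋) : proj₀ (ι a * x) = (0 : k) := by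
  simp [proj₀, TensorAlgebra.algebraMapInv]

/-- Auxiliary: state of the outer recursion, a pair `(a', a' ⧢ -)`. -/
abbrev OuterState (k A : Type*) [CommRing k] [CommRing A] [Algebra k A] : Type _ :=
  TensorAlgebra k A × (TensorAlgebra k A →ₗ[k] TensorAlgebra k A)

/-- Auxiliary: state of the inner recursion. -/
abbrev InnerState (k A : Type*) [CommRing k] [CommRing A] [Algebra k A] : Type _ :=
  TensorAlgebra k A × (A →ₗ[k] OuterState k A →ₗ[k] TensorAlgebra k A)

/-- Auxiliary: initial state of the inner recursion. -/
def innerStart : InnerState k A :=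
  (1, LinearMap.mk₂ k (fun a w => ι a * w.1)
    (by intros; simp [add_mul]) (by intros; simp)
    (by intros; simp [mul_add]) (by intros; simp))

/-- Auxiliary: one step of the inner recursion. -/
def innerStep (lam : k) : A →ₗ[k] InnerState k A →ₗ[k] InnerState k A :=
  LinearMap.mk₂ k (fun b n => (ι b * n.1,
    LinearMap.mk₂ k (fun a w => ι a * w.2 (ι b * n.1) + ι b * n.2 a w
        + (lam * proj₀ w.1) • (ι (a * b) * n.1) - ι (a * b) * n.2 1 w)
      (by intros; simp [add_mul, mul_add]; abel)
      (by intros; simp [smul_sub, smul_smul, mul_comm, mul_left_comm])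
      (by intros; simp [mul_add, add_smul]; abel)
      (by intros; simp [smul_sub, smul_smul, mul_left_comm])))
    (by
      intros
      refine Prod.ext (by simp [add_mul]) ?_
      ext <;> simp [add_mul, mul_add] <;> abel)
    (by
      intros
      refine Prod.ext (by simp) ?_
      ext <;> simp [smul_sub, smul_smul, mul_comm])
    (by
      intros
      refine Prod.ext (by simp [mul_add]) ?_
      ext <;> simp [mul_add] <;> abel)
    (by
      intros
      refine Prod.ext (by simp) ?_
      ext <;> simp [smul_sub, smul_smul, mul_comm])

/-- Auxiliary: one step of the outer recursion. -/
def outerStep (lam : k) : A →ₗ[k] OuterState k A →ₗ[k] OuterState k A :=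
  LinearMap.mk₂ k (fun a w => (ι a * w.1,
    { toFun := fun y => (fold (innerStep lam) innerStart y).2 a w
      map_add' := by intros; simp
      map_smul' := by intros; simp }))
    (by intros; refine Prod.ext (by simp [add_mul]) (LinearMap.ext fun y => by simp))
    (by intros; refine Prod.ext (by simp) (LinearMap.ext fun y => by simp))
    (by intros; refine Prod.ext (by simp [mul_add]) (LinearMap.ext fun y => by simp))
    (by intros; refine Prod.ext (by simp) (LinearMap.ext fun y => by simp))

/-- Auxiliary: a solution of the recursion. -/
def preShuffle (lam : k) : 𝕋 →ₗ[k] 𝕋 →ₗ[k] 𝕋 :=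
  LinearMap.snd k _ _ ∘ₗ fold (outerStep lam) (1, LinearMap.id)

theorem outer_fst (lam : k) (x : 𝕋) :
    (fold (outerStep lam) (1, LinearMap.id) x).1 = x := by
  induction x using cons_induction with
  | h1 => simp [fold_one]
  | hc a x hx => rw [fold_cons]; exact congrArg (ι a * ·) hx
  | hadd x y hx hy => simp [hx, hy]
  | hsmul c x hx => simp [hx]

theorem inner_fst (lam : k) (y : 𝕋) :
    (fold (innerStep lam) innerStart y).1 = y := by
  induction y using cons_induction with
  | h1 => simp [fold_one, innerStart]
  | hc a x hx => rw [fold_cons]; exact congrArg (ι a * ·) hx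
  | hadd x y hx hy => simp [hx, hy]
  | hsmul c x hx => simp [hx]

theorem innerStep_snd (lam : k) (b : A) (n : InnerState k A) (a : A) (w : OuterState k A) :
    (innerStep lam b n).2 a w = ι a * w.2 (ι b * n.1) + ι b * n.2 a w
        + (lam * proj₀ w.1) • (ι (a * b) * n.1) - ι (a * b) * n.2 1 w := rfl

theorem preShuffle_one (lam : k) (y : 𝕋) : preShuffle lam 1 y = y := by
  simp [preShuffle, fold_one]

theorem preShuffle_cons (lam : k) (a : A) (x y : 𝕋) : preShuffle lam (ι a * x) y =
    (fold (innerStep lam) innerStart y).2 a (fold (outerStep lam) (1, LinearMap.id) x) := by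
  simp [preShuffle, fold_cons, outerStep]

theorem preShuffle_cons_one (lam : k) (a : A) (x : 𝕋) :
    preShuffle lam (ι a * x) 1 = ι a * x := by
  rw [preShuffle_cons, fold_one]; simp [innerStart, outer_fst]

theorem preShuffle_one_right (lam : k) (x : 𝕋) : preShuffle lam x 1 = x := by
  induction x using cons_induction with
  | h1 => rw [preShuffle_one]
  | hc a x hx => exact preShuffle_cons_one lam a x
  | hadd x y hx hy => simp [hx, hy]
  | hsmul c x hx => simp [hx]

theorem preShuffle_cons_cons (lam : k) (a b : A) (x y : 𝕋) :
    preShuffle lam (ι a * x) (ι b * y) =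
      ι a * preShuffle lam x (ι b * y) + ι b * preShuffle lam (ι a * x) y
        + (lam * proj₀ x) • (ι (a * b) * y) - ι (a * b) * preShuffle lam (ι 1 * x) y := by
  rw [preShuffle_cons, fold_cons, preShuffle_cons, preShuffle_cons, innerStep_snd, inner_fst,
    outer_fst]
  rfl

theorem preShuffle_ι_one (lam : k) (x : 𝕋) :
    preShuffle lam x (ι 1) = ι 1 * x + lam • x - (lam * proj₀ x) • 1 := by
  induction x using cons_induction with
  | h1 => simp [preShuffle_one, proj₀_one]
  | hc a x hx =>
    have h := preShuffle_cons_cons lam a 1 x 1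
    simp only [mul_one, preShuffle_one_right, hx] at h
    rw [h, proj₀_cons]
    simp only [mul_add, mul_sub, mul_smul_comm, mul_one, mul_zero, zero_smul]
    abel
  | hadd x y hx hy =>
    simp only [map_add, LinearMap.add_apply, hx, hy, mul_add, add_smul, smul_add]
    abel
  | hsmul c x hx => simp [hx, smul_sub, smul_smul, mul_comm, mul_left_comm]

theorem isTDShuffle_preShuffle (lam : k) : IsTDShuffle (A := A) lam (preShuffle lam) where
  one_left := preShuffle_one lam
  one_right := preShuffle_one_right lam
  cons_cons a b x y := by
    rw [preShuffle_cons_cons, preShuffle_ι_one]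
    simp only [map_add, map_sub, map_smul, LinearMap.add_apply, LinearMap.sub_apply,
      LinearMap.smul_apply, preShuffle_one, mul_add, mul_sub, mul_smul_comm]
    abel

theorem IsTDShuffle.ι_one_right {lam : k} {S : 𝕋 →ₗ[k] 𝕋 →ₗ[k] 𝕋} (hS : IsTDShuffle lam S)
    (x : 𝕋) : S x (ι 1) = ι 1 * x + lam • x - (lam * proj₀ x) • 1 := by
  induction x using cons_induction with
  | h1 => simp [hS.one_left, proj₀_one]
  | hc a x hx =>
    have h := hS.cons_cons a 1 x 1
    simp only [mul_one, hS.one_right, hx] at h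
    rw [h, proj₀_cons]
    simp only [mul_add, mul_sub, mul_smul_comm, mul_one, mul_zero, zero_smul]
    abel
  | hadd x y hx hy =>
    simp only [map_add, LinearMap.add_apply, hx, hy, mul_add, add_smul, smul_add]
    abel
  | hsmul c x hx => simp [hx, smul_sub, smul_smul, mul_comm, mul_left_comm]

theorem IsTDShuffle.eq {lam : k} {S S' : 𝕋 →ₗ[k] 𝕋 →ₗ[k] 𝕋} (hS : IsTDShuffle lam S)
    (hS' : IsTDShuffle lam S') : S = S' := by
  refine LinearMap.ext fun x => ?_
  induction x using cons_induction with
  | h1 => ext y; rw [hS.one_left, hS'.one_left]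
  | hc a x hx =>
    refine LinearMap.ext fun y => ?_
    induction y using cons_induction generalizing a with
    | h1 => rw [hS.one_right, hS'.one_right]
    | hc b y hy =>
      rw [hS.cons_cons, hS'.cons_cons, hS.ι_one_right, hS'.ι_one_right]
      simp only [map_add, map_sub, map_smul, LinearMap.add_apply, LinearMap.sub_apply,
        LinearMap.smul_apply, hx, hS.one_left, hS'.one_left, hy]
    | hadd y z hy hz => simp [hy, hz]
    | hsmul c y hy => simp [hy]
  | hadd x y hx hy => simp [hx, hy]
  | hsmul c x hx => simp [hx]

theorem existsUnique_tdShuffle (lam : k) :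
    ∃! S : 𝕋 →ₗ[k] 𝕋 →ₗ[k] 𝕋, IsTDShuffle lam S :=
  ⟨preShuffle lam, isTDShuffle_preShuffle lam, fun _ h => h.eq (isTDShuffle_preShuffle lam)⟩

/-- The `lam`-TD shuffle product: the unique bilinear operation satisfying its recursion. -/
def tdShuffle (lam : k) : 𝕋 →ₗ[k] 𝕋 →ₗ[k] 𝕋 :=
  (existsUnique_tdShuffle lam).choose

theorem isTDShuffle_tdShuffle (lam : k) : IsTDShuffle (A := A) lam (tdShuffle lam) :=
  (existsUnique_tdShuffle lam).choose_spec.1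

end Shuffle

/-! ### The algebra `Ш(A) = A ⊗ ⨁_{n ≥ 0} A^{⊗ n}` with its operator, coproduct and left counit -/

section Sha

/-- The module `Ш(A) = A ⊗ ⨁_{n ≥ 0} A^{⊗ n} ≅ ⨁_{n ≥ 1} A^{⊗ n}`. -/
abbrev Sha (k A : Type*) [CommRing k] [CommRing A] [Algebra k A] : Type _ :=
  A ⊗[k] TensorAlgebra k A

variable {k A : Type*} [CommRing k] [CommRing A] [Algebra k A]

local notation "ι" => TensorAlgebra.ι k (M := A)
local notation "𝕋" => TensorAlgebra k A

/-- The product `(a₀ ⊗ a') ◇ (b₀ ⊗ b') = a₀ b₀ ⊗ (a' ⧢ b')`. -/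
def shaMul (lam : k) : Sha k A →ₗ[k] Sha k A →ₗ[k] Sha k A :=
  TensorProduct.map₂ (LinearMap.mul k A) (tdShuffle lam)

/-- The unit `1_A` of `Ш(A)`. -/
def shaOne : Sha k A := 1 ⊗ₜ 1

/-- The natural embedding `j_A : A → Ш(A)`. -/
def shaIncl : A →ₗ[k] Sha k A := (TensorProduct.mk k A 𝕋).flip 1

/-- The right-shift operator `P(a₀ ⊗ a') = 1_A ⊗ a₀ ⊗ a'`. -/
def shaP : Sha k A →ₗ[k] Sha k A :=
  TensorProduct.mk k A 𝕋 1 ∘ₗ TensorProduct.lift (LinearMap.mul k 𝕋 ∘ₗ ι)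

/-- One step of the recursion for the coproduct: given `g = (b ↦ Δ(b ⊗ x'))`, it returns
`a ↦ Δ_A(a) • (id ⊗ P) (g b)`, which is to be `a ↦ Δ(a ⊗ b ⊗ x')`. -/
def comulStep (lam : k) (ΔA : A →ₗ[k] A ⊗[k] A) :
    A →ₗ[k] (A →ₗ[k] Sha k A ⊗[k] Sha k A) →ₗ[k] (A →ₗ[k] Sha k A ⊗[k] Sha k A) :=
  LinearMap.mk₂ k (fun b g =>
    (tensorMul (shaMul lam)).flip (shaP.lTensor (Sha k A) (g b)) ∘ₗ
      TensorProduct.map shaIncl shaIncl ∘ₗ ΔA)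
    (by intros; ext; simp) (by intros; ext; simp) (by intros; ext; simp) (by intros; ext; simp)

/-- The coproduct of `Ш(A)`, defined on `⨁_{n ≥ 1} A^{⊗ n}` by recursion:
`Δ(a) = Δ_A(a)` and `Δ(a₁ ⊗ a') = Δ_A(a₁) • (id ⊗ P) Δ(a')`. -/
def shaComul (lam : k) (ΔA : A →ₗ[k] A ⊗[k] A) : Sha k A →ₗ[k] Sha k A ⊗[k] Sha k A :=
  TensorProduct.lift
    (fold (comulStep lam ΔA) (TensorProduct.map shaIncl shaIncl ∘ₗ ΔA)).flip

theorem shaComul_incl (lam : k) (ΔA : A →ₗ[k] A ⊗[k] A) (a : A) :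
    shaComul lam ΔA (a ⊗ₜ 1) = TensorProduct.map shaIncl shaIncl (ΔA a) := by
  simp [shaComul, fold_one]

theorem shaComul_cons (lam : k) (ΔA : A →ₗ[k] A ⊗[k] A) (a b : A) (x : 𝕋) :
    shaComul lam ΔA (a ⊗ₜ (ι b * x)) = tensorMul (shaMul lam)
      (TensorProduct.map shaIncl shaIncl (ΔA a))
      (shaP.lTensor (Sha k A) (shaComul lam ΔA (b ⊗ₜ x))) := by
  simp [shaComul, fold_cons, comulStep]

/-- The left counit of `Ш(A)`: it is `ε_A` on `A` and vanishes on `A^{⊗ n}` for `n ≥ 2`. -/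
def shaCounit (εA : A →ₗ[k] k) : Sha k A →ₗ[k] k :=
  LinearMap.mul' k k ∘ₗ TensorProduct.map εA proj₀

theorem shaCounit_incl (εA : A →ₗ[k] k) (a : A) : shaCounit εA (a ⊗ₜ[k] (1 : 𝕋)) = εA a := by
  simp [shaCounit, proj₀_one]

theorem shaCounit_cons (εA : A →ₗ[k] k) (a b : A) (x : 𝕋) :
    shaCounit εA (a ⊗ₜ[k] (ι b * x)) = 0 := by
  simp [shaCounit, proj₀_cons]

/-- The degree `deg a = min {n | a ∈ Aⁿ}` for an exhaustive filtration of `A`. -/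
def deg (F : ℕ → Submodule k A) (a : A) : ℕ := sInf {n | a ∈ F n}

/-- The degree filtration of `Ш(A)`: `Ш(A)ⁿ` is the span of the pure tensors
`a₁ ⊗ ⋯ ⊗ aₘ` with `deg a₁ + ⋯ + deg aₘ + m - 1 ≤ n`. Here `l = [a₂, …, aₘ]`. -/
def shaFiltration (F : ℕ → Submodule k A) (n : ℕ) : Submodule k (Sha k A) :=
  Submodule.span k {z | ∃ (a : A) (l : List A),
    deg F a + (l.map (deg F)).sum + l.length ≤ n ∧ z = a ⊗ₜ[k] (l.map ι).prod}

/-- `(Ш, m, one, P)` with `j : A → Ш` is a free commutative `lam`-TD algebra on `A`: it is a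
commutative `lam`-TD algebra, `j` is a homomorphism of algebras, and every algebra homomorphism from
`A` to a commutative `lam`-TD algebra `(R, Q)` (in the universe `w`) factors uniquely through `j` by
a homomorphism of `lam`-TD algebras. -/
structure IsFreeCommTDAlgebra.{w, u, v, x} {k : Type u} {A : Type v} [CommRing k] [CommRing A]
    [Algebra k A] {H : Type x} [AddCommGroup H] [Module k H] (lam : k)
    (m : H →ₗ[k] H →ₗ[k] H) (one : H) (P : H →ₗ[k] H) (j : A →ₗ[k] H) : Prop where
  isAlgebra : IsUnitaryCommAlgebra m one
  isTD : IsTDOperator lam m one P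
  incl_one : j 1 = one
  incl_mul : ∀ a b, j (a * b) = m (j a) (j b)
  existsUnique_lift : ∀ (R : Type w) [CommRing R] [Algebra k R] (Q : R →ₗ[k] R),
    IsTDOperator lam (LinearMap.mul k R) 1 Q → ∀ f : A →ₐ[k] R,
      ∃! g : H →ₗ[k] R, g one = 1 ∧ (∀ y z, g (m y z) = g y * g z) ∧
        (∀ y, g (P y) = Q (g y)) ∧ ∀ a, g (j a) = f a

end Sha

end TDHopf

end

universe w u v

open scoped TensorProduct

noncomputable section

namespace TDHopf

/-! ### Algebras and TD operators on tensor products, with products as bilinear maps -/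

section TensorAlgebras

variable {k M N : Type*} [CommRing k] [AddCommGroup M] [Module k M] [AddCommGroup N] [Module k N]

/-! Shuffle: solving the recursion for `x ш 1_A` and `(1_A ⊗ x) ш y` turns its last two terms into
the single term `ab ⊗ W(x ш y)`, where `W(w) = λ ε₀(w) - 1_A ⊗ w` is `tdWeight` and `ε₀` is the
projection to `k`. Moreover `W(w) ш z = W(w ш z)`. So the product is a quasi-shuffle whose
contraction carries a weight linear over the product, and commutativity and associativity follow by
induction on lengths.

Freeness: `a ⊗ b ⊗ x = j(a) ◇ P(b ⊗ x)`, so `A` generates `Ш(A)` under product and operator, and the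
extension of `f` is forced to be `a ⊗ x ↦ f(a) t(x)` with `t(a ⊗ x) = Q(f(a) t(x))`. The TD identity
in the target makes `t` multiplicative (`shaLiftTail_tdShuffle`).

Bialgebra: `Ш(A) ⊗ Ш(A)` with `id ⊗ P` is again a TD algebra, and `Δ` is the extension to `Ш(A)` of
`(j ⊗ j) Δ_A`. Hence `Δ` is multiplicative and satisfies the cocycle identity. Coassociativity and
the left counit law compare two homomorphisms of operated algebras that agree on `A`, so
`sha_hom_ext` gives them.

Antipode: let `L(g) = id * g`. In a connected filtration the left counit forces `Δ x - 1 ⊗ x ∈ H ⊗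
H^{n-1}` for `x ∈ Hⁿ`, so `1 - L` pushes the vanishing of a map one filtration step further. The
Neumann series `∑ (1 - L)ⁱ` applied to the map `x ↦ ε(x) 1` is then locally finite and solves `L(S)
= ε(·) 1`. -/

theorem IsUnitaryCommAlgebra.mul_one {m : M →ₗ[k] M →ₗ[k] M} {one : M}
    (h : IsUnitaryCommAlgebra m one) (x : M) : m x one = x := by
  rw [h.comm, h.one_mul]

theorem IsUnitaryCommAlgebra.left_comm {m : M →ₗ[k] M →ₗ[k] M} {one : M}
    (h : IsUnitaryCommAlgebra m one) (x y z : M) : m x (m y z) = m y (m x z) := by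
  rw [← h.assoc, h.comm x y, h.assoc]

theorem IsUnitaryCommAlgebra.mul_mul_mul_comm {m : M →ₗ[k] M →ₗ[k] M} {one : M}
    (h : IsUnitaryCommAlgebra m one) (x y z w : M) :
    m (m x y) (m z w) = m (m x z) (m y w) := by
  rw [h.assoc, h.left_comm y, ← h.assoc]

theorem isUnitaryCommAlgebra_mul (k A : Type*) [CommRing k] [CommRing A] [Algebra k A] :
    IsUnitaryCommAlgebra (LinearMap.mul k A) (1 : A) where
  assoc x y z := by simp [mul_assoc]
  comm x y := by simp [mul_comm]
  one_mul x := by simp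

theorem IsUnitaryCommAlgebra.map₂ {m : M →ₗ[k] M →ₗ[k] M} {one : M}
    {m' : N →ₗ[k] N →ₗ[k] N} {one' : N}
    (h : IsUnitaryCommAlgebra m one) (h' : IsUnitaryCommAlgebra m' one') :
    IsUnitaryCommAlgebra (TensorProduct.map₂ m m') (one ⊗ₜ[k] one') where
  assoc x y z := by
    induction x using TensorProduct.induction_on with
    | zero => simp
    | add x x' hx hx' => simp only [map_add, LinearMap.add_apply, hx, hx']
    | tmul a b =>
      induction y using TensorProduct.induction_on with
      | zero => simp
      | add x x' hx hx' => simp only [map_add, LinearMap.add_apply, hx, hx']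
      | tmul c d =>
        induction z using TensorProduct.induction_on with
        | zero => simp
        | add x x' hx hx' => simp only [map_add, hx, hx']
        | tmul e f => simp only [TensorProduct.map₂_apply_tmul, TensorProduct.map_tmul,
          h.assoc, h'.assoc]
  comm x y := by
    induction x using TensorProduct.induction_on with
    | zero => simp
    | add x x' hx hx' => simp only [map_add, LinearMap.add_apply, hx, hx']
    | tmul a b =>
      induction y using TensorProduct.induction_on with
      | zero => simp
      | add x x' hx hx' => simp only [map_add, LinearMap.add_apply, hx, hx']
      | tmul c d => simp only [TensorProduct.map₂_apply_tmul, TensorProduct.map_tmul,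
        h.comm a, h'.comm b]
  one_mul x := by
    induction x using TensorProduct.induction_on with
    | zero => simp
    | add x x' hx hx' => simp only [map_add, hx, hx']
    | tmul a b => simp only [TensorProduct.map₂_apply_tmul, TensorProduct.map_tmul,
      h.one_mul, h'.one_mul]

/-- On pure tensors the first factor contributes the same product to every term, because `id ⊗ P`
sends the unit to `1 ⊗ P(1)`. This makes `Ш(A) ⊗ Ш(A)` an admissible target for the extension that
defines `Δ`. -/
theorem IsTDOperator.lTensor {lam : k} {m : M →ₗ[k] M →ₗ[k] M} {one : M} {P : M →ₗ[k] M}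
    (h : IsTDOperator lam m one P) {m' : N →ₗ[k] N →ₗ[k] N} {one' : N}
    (h' : IsUnitaryCommAlgebra m' one') :
    IsTDOperator lam (TensorProduct.map₂ m' m) (one' ⊗ₜ[k] one) (P.lTensor N) := by
  intro x y
  induction x using TensorProduct.induction_on with
  | zero => simp
  | add x x' hx hx' =>
    simp only [map_add, map_sub, LinearMap.add_apply, smul_add, hx, hx']; abel
  | tmul a b =>
    induction y using TensorProduct.induction_on with
    | zero => simp
    | add x x' hx hx' =>
      simp only [map_add, map_sub, smul_add] at hx hx' ⊢
      rw [hx, hx']; abel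
    | tmul c d =>
      simp only [LinearMap.lTensor_tmul, TensorProduct.map₂_apply_tmul, TensorProduct.map_tmul,
        h b d, h'.mul_one, TensorProduct.tmul_add, TensorProduct.tmul_sub, TensorProduct.tmul_smul, map_add, map_sub,
        map_smul]

/-- The tensor product of two multiplicative maps is multiplicative. -/
theorem map_map₂_of_multiplicative {M' N' : Type*} [AddCommGroup M'] [Module k M']
    [AddCommGroup N'] [Module k N']
    {m : M →ₗ[k] M →ₗ[k] M} {n : N →ₗ[k] N →ₗ[k] N} {m' : M' →ₗ[k] M' →ₗ[k] M'}
    {n' : N' →ₗ[k] N' →ₗ[k] N'} {f : M →ₗ[k] M'} {g : N →ₗ[k] N'}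
    (hf : ∀ x y, f (m x y) = m' (f x) (f y)) (hg : ∀ x y, g (n x y) = n' (g x) (g y))
    (x y : M ⊗[k] N) : TensorProduct.map f g (TensorProduct.map₂ m n x y) =
      TensorProduct.map₂ m' n' (TensorProduct.map f g x) (TensorProduct.map f g y) := by
  induction x using TensorProduct.induction_on with
  | zero => simp
  | add x x' hx hx' => simp only [map_add, LinearMap.add_apply, hx, hx']
  | tmul a b =>
    induction y using TensorProduct.induction_on with
    | zero => simp
    | add x x' hx hx' => simp only [map_add, hx, hx']
    | tmul c d => simp only [TensorProduct.map₂_apply_tmul, TensorProduct.map_tmul, hf, hg]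

end TensorAlgebras

/-! ### Commutativity and associativity of the TD shuffle product -/

section Shuffle

variable {k A : Type*} [CommRing k] [CommRing A] [Algebra k A]

local notation "ι" => TensorAlgebra.ι k (M := A)
local notation "𝕋" => TensorAlgebra k A

theorem tdShuffle_one_left (lam : k) (y : 𝕋) : tdShuffle lam 1 y = y :=
  (isTDShuffle_tdShuffle lam).one_left y

theorem tdShuffle_one_right (lam : k) (x : 𝕋) : tdShuffle lam x 1 = x :=
  (isTDShuffle_tdShuffle lam).one_right x

/-- Every term of the recursion begins with a letter, so two tensors of positive length have a
product without component in `k`. Multiplicativity of the counit of `Ш(A)` rests on this. -/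
theorem proj₀_tdShuffle (lam : k) (x y : 𝕋) :
    proj₀ (tdShuffle lam x y) = proj₀ x * proj₀ y := by
  induction x using cons_induction with
  | h1 => rw [tdShuffle_one_left, proj₀_one, one_mul]
  | hc a x ih =>
    clear ih
    induction y using cons_induction with
    | h1 => rw [tdShuffle_one_right, proj₀_one, mul_one]
    | hc b y _ =>
      rw [(isTDShuffle_tdShuffle lam).cons_cons]
      simp only [map_add, map_sub, map_smul, proj₀_cons]
      simp
    | hadd x y hx hy => simp only [map_add, hx, hy, mul_add]
    | hsmul c x hx => simp only [map_smul, hx, mul_smul_comm]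
  | hadd x y hx hy => simp only [map_add, LinearMap.add_apply, hx, hy, add_mul]
  | hsmul c x hx => simp only [map_smul, LinearMap.smul_apply, hx, smul_mul_assoc]

/-- Substituting the formula for `x ш 1_A` in the recursion with first letter `1_A` cancels the
second and third terms, so no induction hypothesis on `y` is needed. -/
theorem tdShuffle_ι_one_cons (lam : k) (x y : 𝕋) : tdShuffle lam (ι 1 * x) y =
    ι 1 * tdShuffle lam x y + (lam * proj₀ x) • y
      - (lam * proj₀ (tdShuffle lam x y)) • (1 : 𝕋) := by
  induction y using cons_induction with
  | h1 => simp only [tdShuffle_one_right, add_sub_cancel_right]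
  | hc b y _ =>
    rw [(isTDShuffle_tdShuffle lam).cons_cons, proj₀_tdShuffle, proj₀_cons,
      (isTDShuffle_tdShuffle lam).ι_one_right]
    simp only [map_add, map_sub, map_smul, LinearMap.add_apply, LinearMap.sub_apply,
      LinearMap.smul_apply, tdShuffle_one_left, mul_add, mul_sub, mul_smul_comm, mul_zero,
      zero_smul, one_mul]
    abel
  | hadd x y hx hy => simp only [map_add, hx, hy, mul_add, add_smul, smul_add]; abel
  | hsmul c x hx =>
    simp only [map_smul, hx, mul_smul_comm, smul_add, smul_sub, smul_eq_mul, smul_smul,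
      mul_left_comm, mul_comm]

/-- The operator `w ↦ lam ε(w) - 1_A ⊗ w`, which weights the contraction of two letters in the
`lam`-TD shuffle product. -/
def tdWeight (lam : k) : 𝕋 →ₗ[k] 𝕋 :=
  (lam • proj₀).smulRight (1 : 𝕋) - LinearMap.mulLeft k (ι 1)

theorem tdWeight_apply (lam : k) (w : 𝕋) :
    tdWeight lam w = (lam * proj₀ w) • (1 : 𝕋) - ι 1 * w := by
  simp [tdWeight]

/-- The quasi-shuffle form of the recursion: in `(x ш 1_A) ш y` the part `λ (x ш y)` cancels the `λ`
term, and what remains depends on `x ш y` alone. -/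
theorem tdShuffle_cons_cons (lam : k) (a b : A) (x y : 𝕋) :
    tdShuffle lam (ι a * x) (ι b * y) = ι a * tdShuffle lam x (ι b * y)
      + ι b * tdShuffle lam (ι a * x) y + ι (a * b) * tdWeight lam (tdShuffle lam x y) := by
  rw [(isTDShuffle_tdShuffle lam).cons_cons, (isTDShuffle_tdShuffle lam).ι_one_right,
    tdWeight_apply]
  simp only [map_add, map_sub, map_smul, LinearMap.add_apply, LinearMap.sub_apply,
    LinearMap.smul_apply, tdShuffle_one_left, tdShuffle_ι_one_cons, mul_add, mul_sub,
    mul_smul_comm]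
  abel

theorem tdShuffle_tdWeight (lam : k) (w z : 𝕋) :
    tdShuffle lam (tdWeight lam w) z = tdWeight lam (tdShuffle lam w z) := by
  rw [tdWeight_apply, tdWeight_apply, map_sub, LinearMap.sub_apply, tdShuffle_ι_one_cons, map_smul,
    LinearMap.smul_apply, tdShuffle_one_left]
  abel

theorem tdShuffle_comm (lam : k) (x y : 𝕋) : tdShuffle lam x y = tdShuffle lam y x := by
  induction x using cons_induction generalizing y with
  | h1 => rw [tdShuffle_one_left, tdShuffle_one_right]
  | hc a x hx =>
    induction y using cons_induction with
    | h1 => rw [tdShuffle_one_left, tdShuffle_one_right]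
    | hc b y hy =>
      rw [tdShuffle_cons_cons, tdShuffle_cons_cons, hx, hx, hy, mul_comm a b]
      abel
    | hadd x y hx hy => simp only [map_add, LinearMap.add_apply, hx, hy]
    | hsmul c x hx => simp only [map_smul, LinearMap.smul_apply, hx]
  | hadd x y hx hy => simp only [map_add, LinearMap.add_apply, hx, hy]
  | hsmul c x hx => simp only [map_smul, LinearMap.smul_apply, hx]

theorem tdShuffle_tdWeight_right (lam : k) (w z : 𝕋) :
    tdShuffle lam z (tdWeight lam w) = tdWeight lam (tdShuffle lam z w) := by
  rw [tdShuffle_comm, tdShuffle_tdWeight, tdShuffle_comm]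

theorem tdShuffle_assoc (lam : k) (x y z : 𝕋) :
    tdShuffle lam (tdShuffle lam x y) z = tdShuffle lam x (tdShuffle lam y z) := by
  induction x using cons_induction generalizing y z with
  | h1 => rw [tdShuffle_one_left, tdShuffle_one_left]
  | hc a x hx =>
    induction y using cons_induction generalizing z with
    | h1 => rw [tdShuffle_one_left, tdShuffle_one_right]
    | hc b y hy =>
      induction z using cons_induction with
      | h1 => rw [tdShuffle_one_right, tdShuffle_one_right]
      | hc c z hz =>
        -- The terms starting with `c` on the left are `c ⊗ (- ш z)`, one for each of the three
        -- terms of the inner product; the hypothesis on `z`, split the same way, regroups them.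
        rw [tdShuffle_cons_cons lam a b] at hz
        simp only [map_add, LinearMap.add_apply] at hz
        simp only [tdShuffle_cons_cons, map_add, LinearMap.add_apply, hx, hy, mul_add, mul_assoc,
          tdShuffle_tdWeight, tdShuffle_tdWeight_right]
        rw [← hz]
        simp only [mul_add]
        abel
      | hadd x y hx hy => simp only [map_add, hx, hy]
      | hsmul c x hx => simp only [map_smul, hx]
    | hadd x y hx hy => simp only [map_add, LinearMap.add_apply, hx, hy]
    | hsmul c x hx => simp only [map_smul, LinearMap.smul_apply, hx]
  | hadd x y hx hy => simp only [map_add, LinearMap.add_apply, hx, hy]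
  | hsmul c x hx => simp only [map_smul, LinearMap.smul_apply, hx]

theorem isUnitaryCommAlgebra_tdShuffle (lam : k) :
    IsUnitaryCommAlgebra (tdShuffle (A := A) lam) 1 where
  assoc := tdShuffle_assoc lam
  comm := tdShuffle_comm lam
  one_mul := tdShuffle_one_left lam

end Shuffle

/-! ### Universal property of the free commutative TD algebra -/

section Free

variable {k A : Type*} [CommRing k] [CommRing A] [Algebra k A]

local notation "ι" => TensorAlgebra.ι k (M := A)
local notation "𝕋" => TensorAlgebra k A

theorem shaMul_tmul (lam : k) (a b : A) (x y : 𝕋) :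
    shaMul lam (a ⊗ₜ x) (b ⊗ₜ y) = (a * b) ⊗ₜ[k] tdShuffle lam x y := by
  simp [shaMul, TensorProduct.map₂_apply_tmul]

theorem shaIncl_apply (a : A) : shaIncl a = a ⊗ₜ[k] (1 : 𝕋) := rfl

theorem shaP_tmul (a : A) (x : 𝕋) : shaP (a ⊗ₜ x) = 1 ⊗ₜ[k] (ι a * x) := by
  simp [shaP]

/-- The reason `A` generates `Ш(A)` as an operated algebra. -/
theorem shaMul_incl_shaP (lam : k) (a b : A) (x : 𝕋) :
    shaMul lam (shaIncl a) (shaP (b ⊗ₜ x)) = a ⊗ₜ[k] (ι b * x) := by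
  rw [shaIncl_apply, shaP_tmul, shaMul_tmul, mul_one, tdShuffle_one_left]

theorem sha_induction {p : Sha k A → Prop} (hincl : ∀ a, p (shaIncl a))
    (hcons : ∀ (a b : A) (x : 𝕋), p (b ⊗ₜ x) → p (a ⊗ₜ (ι b * x)))
    (hadd : ∀ x y, p x → p y → p (x + y)) (x : Sha k A) : p x := by
  induction x using TensorProduct.induction_on with
  | zero => simpa using hincl 0
  | add x y hx hy => exact hadd x y hx hy
  | tmul a y =>
    induction y using cons_induction generalizing a with
    | h1 => exact hincl a
    | hc b x hx => exact hcons a b x (hx b)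
    | hadd x y hx hy => rw [TensorProduct.tmul_add]; exact hadd _ _ (hx a) (hy a)
    -- The scalar is absorbed by the head letter, over which the induction is general.
    | hsmul c x hx => rw [← TensorProduct.smul_tmul]; exact hx _

theorem isUnitaryCommAlgebra_shaMul (lam : k) :
    IsUnitaryCommAlgebra (shaMul (A := A) lam) shaOne :=
  (isUnitaryCommAlgebra_mul k A).map₂ (isUnitaryCommAlgebra_tdShuffle lam)

theorem isTDOperator_shaP (lam : k) :
    IsTDOperator lam (shaMul (A := A) lam) shaOne shaP := by
  intro x y
  induction x using TensorProduct.induction_on with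
  | zero => simp
  | add x x' hx hx' =>
    simp only [map_add, map_sub, LinearMap.add_apply, smul_add, hx, hx']; abel
  | tmul a x =>
    induction y using TensorProduct.induction_on with
    | zero => simp
    | add x x' hx hx' =>
      simp only [map_add, map_sub, smul_add] at hx hx' ⊢
      rw [hx, hx']; abel
    | tmul b y =>
      simp only [shaOne, shaP_tmul, shaMul_tmul, map_add, map_sub, map_smul, mul_one, one_mul,
        (isTDShuffle_tdShuffle lam).cons_cons, TensorProduct.tmul_add, TensorProduct.tmul_sub,
        TensorProduct.tmul_smul]

theorem shaIncl_mul (lam : k) (a b : A) :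
    shaIncl (a * b) = shaMul lam (shaIncl a) (shaIncl (k := k) b) := by
  rw [shaIncl_apply, shaIncl_apply, shaIncl_apply, shaMul_tmul, tdShuffle_one_left]

variable {R : Type*} [AddCommGroup R] [Module k R]

/-- A homomorphism of operated algebras on `Ш(A)` is determined by its restriction to `A`. -/
theorem sha_hom_ext {lam : k} {m : R →ₗ[k] R →ₗ[k] R} {Q : R →ₗ[k] R} {g g' : Sha k A →ₗ[k] R}
    (hmul : ∀ x y, g (shaMul lam x y) = m (g x) (g y)) (hP : ∀ x, g (shaP x) = Q (g x))
    (hmul' : ∀ x y, g' (shaMul lam x y) = m (g' x) (g' y)) (hP' : ∀ x, g' (shaP x) = Q (g' x))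
    (hincl : ∀ a, g (shaIncl a) = g' (shaIncl a)) : g = g' := by
  refine LinearMap.ext fun x => ?_
  induction x using sha_induction with
  | hincl a => exact hincl a
  | hcons a b x hx =>
    rw [← shaMul_incl_shaP lam, hmul, hmul', hP, hP', hx, hincl]
  | hadd x y hx hy => rw [map_add, map_add, hx, hy]

/-- The restriction to `⨁_{n ≥ 0} A^{⊗ n}` of the extension of `f : A → R` to `Ш(A)`. -/
def shaLiftTail (m : R →ₗ[k] R →ₗ[k] R) (one : R) (Q : R →ₗ[k] R) (f : A →ₗ[k] R) : 𝕋 →ₗ[k] R :=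
  fold ((m ∘ₗ f).compr₂ Q) one

/-- The extension of `f : A → R` to a homomorphism of operated algebras from `Ш(A)`. -/
def shaLift (m : R →ₗ[k] R →ₗ[k] R) (one : R) (Q : R →ₗ[k] R) (f : A →ₗ[k] R) :
    Sha k A →ₗ[k] R :=
  TensorProduct.lift ((m ∘ₗ f).compl₂ (shaLiftTail m one Q f))

section Lift

variable {lam : k} {m : R →ₗ[k] R →ₗ[k] R} {one : R} {Q : R →ₗ[k] R} {f : A →ₗ[k] R}

theorem shaLiftTail_one : shaLiftTail m one Q f 1 = one := fold_one _ _

theorem shaLiftTail_cons (a : A) (x : 𝕋) :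
    shaLiftTail m one Q f (ι a * x) = Q (m (f a) (shaLiftTail m one Q f x)) :=
  fold_cons _ _ _ _

theorem shaLift_tmul (a : A) (x : 𝕋) :
    shaLift m one Q f (a ⊗ₜ x) = m (f a) (shaLiftTail m one Q f x) := by
  simp [shaLift]

theorem shaLift_incl (hR : IsUnitaryCommAlgebra m one) (a : A) :
    shaLift m one Q f (shaIncl a) = f a := by
  rw [shaIncl_apply, shaLift_tmul, shaLiftTail_one, hR.mul_one]

theorem shaLift_shaP (hR : IsUnitaryCommAlgebra m one) (hf1 : f 1 = one) (x : Sha k A) :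
    shaLift m one Q f (shaP x) = Q (shaLift m one Q f x) := by
  induction x using TensorProduct.induction_on with
  | zero => simp
  | add x y hx hy => simp only [map_add, hx, hy]
  | tmul a x => rw [shaP_tmul, shaLift_tmul, shaLift_tmul, hf1, hR.one_mul, shaLiftTail_cons]

/-- For `w` of positive length its image is some `Q(u)`, and the TD identity for the pair `u, 1`
reads `Q(u) Q(1) = Q(Q(u)) + λ Q(u)`, the two terms `u Q(1)` cancelling. For `w = 1` both sides are
`λ - Q(1)`. -/
theorem shaLiftTail_tdWeight (hR : IsUnitaryCommAlgebra m one) (hQ : IsTDOperator lam m one Q)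
    (hf1 : f 1 = one) (w : 𝕋) :
    shaLiftTail m one Q f (tdWeight lam w) =
      lam • shaLiftTail m one Q f w - m (shaLiftTail m one Q f w) (Q one) := by
  induction w using cons_induction with
  | h1 =>
    rw [tdWeight_apply, map_sub, map_smul, shaLiftTail_cons, shaLiftTail_one, proj₀_one, hf1,
      mul_one, hR.one_mul, hR.one_mul]
  | hc a x _ =>
    rw [tdWeight_apply, map_sub, map_smul, shaLiftTail_cons, proj₀_cons, hf1, hR.one_mul,
      shaLiftTail_cons, hQ]
    simp only [mul_zero, zero_smul, map_add, map_sub, map_smul, hR.mul_one]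
    abel
  | hadd x y hx hy => simp only [map_add, LinearMap.add_apply, hx, hy, smul_add]; abel
  | hsmul c x hx => simp only [map_smul, LinearMap.smul_apply, hx, smul_sub, smul_comm c lam]

/-- With `u = f(a) t(x)` and `v = f(b) t(y)`, the TD expansion of `Q(u) Q(v)` matches the recursion:
its first two terms are the shuffle terms, and `λ uv - u Q(1) v` is the weighted contraction. -/
theorem shaLiftTail_tdShuffle (hR : IsUnitaryCommAlgebra m one) (hQ : IsTDOperator lam m one Q)
    (hf1 : f 1 = one) (hf : ∀ a b, f (a * b) = m (f a) (f b)) (x y : 𝕋) :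
    shaLiftTail m one Q f (tdShuffle lam x y) =
      m (shaLiftTail m one Q f x) (shaLiftTail m one Q f y) := by
  induction x using cons_induction generalizing y with
  | h1 => rw [tdShuffle_one_left, shaLiftTail_one, hR.one_mul]
  | hc a x hx =>
    induction y using cons_induction with
    | h1 => rw [tdShuffle_one_right, shaLiftTail_one, hR.mul_one]
    | hc b y hy =>
      rw [tdShuffle_cons_cons]
      simp only [map_add, shaLiftTail_cons _ (tdWeight _ _), shaLiftTail_cons _ (tdShuffle _ _ _),
        shaLiftTail_tdWeight hR hQ hf1, hx, hy, hf]
      simp only [shaLiftTail_cons, hQ _ _, map_add, map_sub, map_smul, hR.assoc]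
      rw [hR.left_comm (Q _) (f b), hR.left_comm (f b) (shaLiftTail m one Q f x),
        hR.left_comm (Q one) (f b), hR.left_comm (f b) (shaLiftTail m one Q f x),
        hR.comm (Q one)]
      abel
    | hadd x y hx hy => simp only [map_add, hx, hy]
    | hsmul c x hx => simp only [map_smul, hx]
  | hadd x y hx hy => simp only [map_add, LinearMap.add_apply, hx, hy]
  | hsmul c x hx => simp only [map_smul, LinearMap.smul_apply, hx]

theorem shaLift_shaMul (hR : IsUnitaryCommAlgebra m one) (hQ : IsTDOperator lam m one Q)
    (hf1 : f 1 = one) (hf : ∀ a b, f (a * b) = m (f a) (f b)) (x y : Sha k A) :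
    shaLift m one Q f (shaMul lam x y) = m (shaLift m one Q f x) (shaLift m one Q f y) := by
  induction x using TensorProduct.induction_on with
  | zero => simp
  | add x x' hx hx' => simp only [map_add, LinearMap.add_apply, hx, hx']
  | tmul a x =>
    induction y using TensorProduct.induction_on with
    | zero => simp
    | add x x' hx hx' => simp only [map_add, hx, hx']
    | tmul b y =>
      rw [shaMul_tmul, shaLift_tmul, shaLift_tmul, shaLift_tmul, hf,
        shaLiftTail_tdShuffle hR hQ hf1 hf, hR.mul_mul_mul_comm]

end Lift

theorem isFreeCommTDAlgebra_sha (lam : k) :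
    IsFreeCommTDAlgebra lam (shaMul (A := A) lam) shaOne shaP shaIncl where
  isAlgebra := isUnitaryCommAlgebra_shaMul lam
  isTD := isTDOperator_shaP lam
  incl_one := rfl
  incl_mul := shaIncl_mul lam
  existsUnique_lift R _ _ Q hQ f := by
    have hR := isUnitaryCommAlgebra_mul k R
    have hf1 : f.toLinearMap 1 = 1 := map_one f
    have hf : ∀ a b, f.toLinearMap (a * b) =
      LinearMap.mul k R (f.toLinearMap a) (f.toLinearMap b) := map_mul f
    have hmul := shaLift_shaMul hR hQ hf1 hf
    have hP := shaLift_shaP (Q := Q) hR hf1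
    have hincl := shaLift_incl (Q := Q) (f := f.toLinearMap) hR
    refine ⟨shaLift (LinearMap.mul k R) 1 Q f.toLinearMap,
      ⟨(hincl 1).trans hf1, hmul, hP, hincl⟩, ?_⟩
    rintro g ⟨_, hg, hgP, hgincl⟩
    exact sha_hom_ext (m := LinearMap.mul k R) hg hgP hmul hP
      fun a => (hgincl a).trans (hincl a).symm

end Free

/-! ### Coproduct and left counit through the universal property -/

section Bialgebra

variable {k A : Type*} [CommRing k] [CommRing A] [Algebra k A]

local notation "ι" => TensorAlgebra.ι k (M := A)
local notation "𝕋" => TensorAlgebra k A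

variable {lam : k} {ΔA : A →ₗ[k] A ⊗[k] A} {εA : A →ₗ[k] k}

theorem shaComul_shaIncl (a : A) :
    shaComul lam ΔA (shaIncl a) = TensorProduct.map shaIncl shaIncl (ΔA a) :=
  shaComul_incl lam ΔA a

theorem isUnitaryCommAlgebra_tensorMul_shaMul (lam : k) :
    IsUnitaryCommAlgebra (tensorMul (shaMul (A := A) lam)) (shaOne ⊗ₜ[k] shaOne) :=
  (isUnitaryCommAlgebra_shaMul lam).map₂ (isUnitaryCommAlgebra_shaMul lam)

theorem map_shaIncl_tensorMul (lam : k) (x y : A ⊗[k] A) :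
    TensorProduct.map shaIncl shaIncl (tensorMul (LinearMap.mul k A) x y) =
      tensorMul (shaMul lam) (TensorProduct.map shaIncl shaIncl x)
        (TensorProduct.map shaIncl shaIncl y) :=
  map_map₂_of_multiplicative (fun a b => shaIncl_mul lam a b) (fun a b => shaIncl_mul lam a b) x y

/-- The coproduct of `Ш(A)` is the homomorphism of operated algebras into
`(Ш(A) ⊗ Ш(A), id ⊗ P)` extending the coproduct of `A`. -/
theorem shaComul_eq_shaLift (lam : k) (hA1 : ΔA 1 = 1 ⊗ₜ 1) :
    shaComul lam ΔA = shaLift (tensorMul (shaMul lam)) (shaOne ⊗ₜ[k] shaOne)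
      (shaP.lTensor (Sha k A)) (TensorProduct.map shaIncl shaIncl ∘ₗ ΔA) := by
  have hR := isUnitaryCommAlgebra_tensorMul_shaMul (A := A) lam
  have h1 : (TensorProduct.map shaIncl shaIncl ∘ₗ ΔA) 1 = shaOne ⊗ₜ[k] (shaOne : Sha k A) := by
    rw [LinearMap.comp_apply, hA1, TensorProduct.map_tmul]; rfl
  refine LinearMap.ext fun x => ?_
  induction x using sha_induction with
  | hincl a => rw [shaComul_shaIncl, shaLift_incl hR]; rfl
  | hcons a b x hx =>
    -- The factor `(id ⊗ P) Δ(b ⊗ x)` is the lift evaluated at `1_A ⊗ b ⊗ x`, which is its tail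
    -- value because `1_A` maps to the unit.
    rw [shaComul_cons, hx, ← shaLift_shaP hR h1, shaP_tmul, shaLift_tmul, shaLift_tmul, h1,
      hR.one_mul]
    rfl
  | hadd x y hx hy => rw [map_add, map_add, hx, hy]

theorem isCocycle_shaComul (lam : k) (hA1 : ΔA 1 = 1 ⊗ₜ 1) :
    IsCocycle (shaComul lam ΔA) shaP := by
  intro x
  rw [shaComul_eq_shaLift lam hA1]
  refine shaLift_shaP (isUnitaryCommAlgebra_tensorMul_shaMul lam) ?_ x
  rw [LinearMap.comp_apply, hA1, TensorProduct.map_tmul]; rfl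

theorem shaComul_shaMul (lam : k) (hA1 : ΔA 1 = 1 ⊗ₜ 1)
    (hA : ∀ a b, ΔA (a * b) = tensorMul (LinearMap.mul k A) (ΔA a) (ΔA b)) (x y : Sha k A) :
    shaComul lam ΔA (shaMul lam x y) =
      tensorMul (shaMul lam) (shaComul lam ΔA x) (shaComul lam ΔA y) := by
  rw [shaComul_eq_shaLift lam hA1]
  refine shaLift_shaMul (isUnitaryCommAlgebra_tensorMul_shaMul lam)
    ((isTDOperator_shaP lam).lTensor (isUnitaryCommAlgebra_shaMul lam)) ?_ (fun a b => ?_) x y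
  · rw [LinearMap.comp_apply, hA1, TensorProduct.map_tmul]; rfl
  · rw [LinearMap.comp_apply, hA, map_shaIncl_tensorMul]; rfl

theorem assoc_map₂ {H : Type*} [AddCommGroup H] [Module k H] (m : H →ₗ[k] H →ₗ[k] H)
    (x y : (H ⊗[k] H) ⊗[k] H) :
    TensorProduct.assoc k H H H (TensorProduct.map₂ (TensorProduct.map₂ m m) m x y) =
      TensorProduct.map₂ m (TensorProduct.map₂ m m) (TensorProduct.assoc k H H H x)
        (TensorProduct.assoc k H H H y) := by
  induction x using TensorProduct.induction_on with
  | zero => simp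
  | add x x' hx hx' => simp only [map_add, LinearMap.add_apply, hx, hx']
  | tmul u c =>
    induction y using TensorProduct.induction_on with
    | zero => simp
    | add x x' hx hx' => simp only [map_add, hx, hx']
    | tmul v f =>
      induction u using TensorProduct.induction_on with
      | zero => simp
      | add x x' hx hx' => simp only [map_add, LinearMap.add_apply, TensorProduct.add_tmul, hx, hx']
      | tmul a b =>
        induction v using TensorProduct.induction_on with
        | zero => simp
        | add x x' hx hx' => simp only [map_add, TensorProduct.add_tmul, hx, hx']
        | tmul d e =>
          simp only [TensorProduct.map₂_apply_tmul, TensorProduct.map_tmul,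
            TensorProduct.assoc_tmul]

theorem shaComul_coassoc (lam : k) (hA1 : ΔA 1 = 1 ⊗ₜ 1)
    (hA : ∀ a b, ΔA (a * b) = tensorMul (LinearMap.mul k A) (ΔA a) (ΔA b))
    (hcoassoc : ∀ a, TensorProduct.assoc k A A A (ΔA.rTensor A (ΔA a)) = ΔA.lTensor A (ΔA a))
    (x : Sha k A) :
    TensorProduct.assoc k _ _ _ ((shaComul lam ΔA).rTensor _ (shaComul lam ΔA x)) =
      (shaComul lam ΔA).lTensor _ (shaComul lam ΔA x) := by
  set D := shaComul lam ΔA with hD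
  have hmul : ∀ x y, D (shaMul lam x y) =
      TensorProduct.map₂ (shaMul lam) (shaMul lam) (D x) (D y) :=
    shaComul_shaMul lam hA1 hA
  have hP : ∀ x, D (shaP x) = shaP.lTensor _ (D x) := isCocycle_shaComul lam hA1
  have hPcomp : D ∘ₗ shaP = shaP.lTensor _ ∘ₗ D := LinearMap.ext hP
  -- Both sides are homomorphisms into the triple tensor product with operator `id ⊗ id ⊗ P`;
  -- uniqueness asks for no TD identity there.
  refine LinearMap.congr_fun (sha_hom_ext (lam := lam)
    (m := TensorProduct.map₂ (shaMul lam) (TensorProduct.map₂ (shaMul lam) (shaMul lam)))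
    (Q := (shaP.lTensor (Sha k A)).lTensor (Sha k A))
    (g := (TensorProduct.assoc k _ _ _).toLinearMap ∘ₗ D.rTensor _ ∘ₗ D)
    (g' := D.lTensor _ ∘ₗ D) ?_ ?_ ?_ ?_ ?_) x
  · intro x y
    simp only [LinearMap.comp_apply, LinearEquiv.coe_coe, hmul]
    rw [← assoc_map₂]
    exact congrArg _ (map_map₂_of_multiplicative (g := LinearMap.id) hmul (fun _ _ => rfl) _ _)
  · intro x
    let P : Sha k A →ₗ[k] Sha k A := shaP
    -- `Δ ⊗ id` acts on the first factor and `id ⊗ P` on the second, so they commute up to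
    -- rebracketing.
    have h : (TensorProduct.assoc k _ _ _).toLinearMap ∘ₗ D.rTensor _ ∘ₗ P.lTensor _ =
        (P.lTensor _).lTensor _ ∘ₗ (TensorProduct.assoc k _ _ _).toLinearMap ∘ₗ D.rTensor _ := by
      refine TensorProduct.ext' fun u v => ?_
      simp only [LinearMap.comp_apply, LinearMap.lTensor_tmul, LinearMap.rTensor_tmul]
      generalize D u = w
      induction w using TensorProduct.induction_on with
      | zero => simp
      | add x y hx hy => simp only [map_add, TensorProduct.add_tmul, hx, hy]
      | tmul a b => simp
    simp only [LinearMap.comp_apply, hP]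
    exact LinearMap.congr_fun h (D x)
  · intro x y
    simp only [LinearMap.comp_apply, hmul]
    exact map_map₂_of_multiplicative (f := LinearMap.id) (fun _ _ => rfl) hmul _ _
  · intro x
    simp only [LinearMap.comp_apply, hP]
    rw [← LinearMap.lTensor_comp_apply, hPcomp, LinearMap.lTensor_comp_apply]
  · intro a
    let j : A →ₗ[k] Sha k A := shaIncl
    -- On `A` both sides are images under `j ⊗ j ⊗ j`, which reduces the claim to coassociativity of
    -- `Δ_A`.
    have h₁ : (TensorProduct.assoc k _ _ _).toLinearMap ∘ₗ D.rTensor _ ∘ₗ TensorProduct.map j j =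
        TensorProduct.map j (TensorProduct.map j j) ∘ₗ
          (TensorProduct.assoc k A A A).toLinearMap ∘ₗ ΔA.rTensor A := by
      refine TensorProduct.ext' fun u v => ?_
      simp only [LinearMap.comp_apply, LinearMap.rTensor_tmul, TensorProduct.map_tmul, hD, j,
        shaComul_shaIncl]
      generalize ΔA u = w
      induction w using TensorProduct.induction_on with
      | zero => simp
      | add x y hx hy => simp only [map_add, TensorProduct.add_tmul, hx, hy]
      | tmul a b => simp
    have h₂ : D.lTensor _ ∘ₗ TensorProduct.map j j =
        TensorProduct.map j (TensorProduct.map j j) ∘ₗ ΔA.lTensor A := by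
      refine TensorProduct.ext' fun u v => ?_
      simp only [LinearMap.comp_apply, LinearMap.lTensor_tmul, TensorProduct.map_tmul, hD, j,
        shaComul_shaIncl]
    have e₁ := LinearMap.congr_fun h₁ (ΔA a)
    have e₂ := LinearMap.congr_fun h₂ (ΔA a)
    simp only [LinearMap.comp_apply, LinearEquiv.coe_coe, j] at e₁ e₂ ⊢
    rw [hD, shaComul_shaIncl, ← hD, e₁, e₂, hcoassoc]

theorem shaCounit_tmul (a : A) (x : 𝕋) : shaCounit εA (a ⊗ₜ[k] x) = εA a * proj₀ x := by
  simp [shaCounit]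

theorem shaCounit_shaMul (lam : k) (hε : ∀ a b, εA (a * b) = εA a * εA b) (x y : Sha k A) :
    shaCounit εA (shaMul lam x y) = shaCounit εA x * shaCounit εA y := by
  induction x using TensorProduct.induction_on with
  | zero => simp
  | add x x' hx hx' => simp only [map_add, LinearMap.add_apply, hx, hx', add_mul]
  | tmul a x =>
    induction y using TensorProduct.induction_on with
    | zero => simp
    | add x x' hx hx' => simp only [map_add, hx, hx', mul_add]
    | tmul b y =>
      rw [shaMul_tmul, shaCounit_tmul, shaCounit_tmul, shaCounit_tmul, hε, proj₀_tdShuffle]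
      ring

theorem shaComul_left_counit (lam : k) (hA1 : ΔA 1 = 1 ⊗ₜ 1)
    (hA : ∀ a b, ΔA (a * b) = tensorMul (LinearMap.mul k A) (ΔA a) (ΔA b))
    (hε : ∀ a b, εA (a * b) = εA a * εA b) (hcounit : ∀ a, εA.rTensor A (ΔA a) = 1 ⊗ₜ[k] a)
    (x : Sha k A) :
    (shaCounit εA).rTensor _ (shaComul lam ΔA x) = 1 ⊗ₜ[k] x := by
  set D := shaComul lam ΔA with hD
  have hmul : ∀ x y, D (shaMul lam x y) =
      TensorProduct.map₂ (shaMul lam) (shaMul lam) (D x) (D y) :=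
    shaComul_shaMul lam hA1 hA
  have hP : ∀ x, D (shaP x) = shaP.lTensor _ (D x) := isCocycle_shaComul lam hA1
  refine LinearMap.congr_fun (sha_hom_ext (lam := lam)
    (m := TensorProduct.map₂ (LinearMap.mul k k) (shaMul lam))
    (Q := shaP.lTensor k)
    (g := (shaCounit εA).rTensor _ ∘ₗ D)
    (g' := TensorProduct.mk k k (Sha k A) 1) ?_ ?_ ?_ ?_ ?_) x
  · intro x y
    simp only [LinearMap.comp_apply, hmul]
    exact map_map₂_of_multiplicative (g := LinearMap.id) (m' := LinearMap.mul k k)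
      (shaCounit_shaMul lam hε) (fun _ _ => rfl) _ _
  · intro x
    simp only [LinearMap.comp_apply, hP]
    exact LinearMap.congr_fun ((LinearMap.rTensor_comp_lTensor _ _ _).trans
      (LinearMap.lTensor_comp_rTensor _ _ _).symm) (D x)
  · intro x y
    simp only [TensorProduct.mk_apply, TensorProduct.map₂_apply_tmul, TensorProduct.map_tmul]
    simp
  · intro x; simp
  · intro a
    have h : (shaCounit εA).rTensor _ ∘ₗ TensorProduct.map shaIncl shaIncl =
        TensorProduct.map LinearMap.id shaIncl ∘ₗ εA.rTensor A := by
      refine TensorProduct.ext' fun u v => ?_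
      simp only [LinearMap.comp_apply, LinearMap.rTensor_tmul, TensorProduct.map_tmul,
        shaIncl_apply, shaCounit_incl, LinearMap.id_apply]
    have e := LinearMap.congr_fun h (ΔA a)
    simp only [LinearMap.comp_apply, hD, shaComul_shaIncl] at e ⊢
    rw [e, hcounit]
    simp

theorem isLeftCounitalBialgebra_sha (lam : k)
    (hA : IsLeftCounitalBialgebra (LinearMap.mul k A) 1 ΔA εA) :
    IsLeftCounitalBialgebra (shaMul lam) shaOne (shaComul lam ΔA) (shaCounit εA) where
  toIsUnitaryCommAlgebra := isUnitaryCommAlgebra_shaMul lam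
  coassoc := shaComul_coassoc lam hA.comul_one hA.comul_mul hA.coassoc
  left_counit :=
    shaComul_left_counit lam hA.comul_one hA.comul_mul hA.counit_mul hA.left_counit
  comul_one := by
    rw [shaOne, shaComul_incl, hA.comul_one, TensorProduct.map_tmul]; rfl
  comul_mul := shaComul_shaMul lam hA.comul_one hA.comul_mul
  counit_one := by rw [shaOne, shaCounit_incl, hA.counit_one]
  counit_mul := shaCounit_shaMul lam hA.counit_mul

end Bialgebra

/-! ### The filtration condition on coproducts -/

section TensorFiltration

variable {k H : Type*} [CommRing k] [AddCommGroup H] [Module k H] {F : ℕ → Submodule k H}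

/-- The submodule `H⁰ ⊗ Hⁿ + ∑_{p + q = n, p, q > 0} H^p ⊗ H^q` of `H ⊗ H`. -/
def comulFiltration (F : ℕ → Submodule k H) (n : ℕ) : Submodule k (H ⊗[k] H) :=
  tensorSub (F 0) (F n) ⊔
    ⨆ (p : ℕ) (q : ℕ) (_ : p + q = n ∧ 0 < p ∧ 0 < q), tensorSub (F p) (F q)

/-- The condition `p = 0 ∨ 0 < q` treats both kinds of summands uniformly: only `p > 0` with `q = 0`
is excluded. It is stable under adding bidegrees and under raising `q`. -/
theorem tmul_mem_comulFiltration (hF : Monotone F) {n p q : ℕ} {x y : H} (hx : x ∈ F p)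
    (hy : y ∈ F q) (hpq : p + q ≤ n) (h : p = 0 ∨ 0 < q) : x ⊗ₜ[k] y ∈ comulFiltration F n := by
  have key : ∀ q', q ≤ q' → x ⊗ₜ[k] y ∈ tensorSub (F p) (F q') := fun q' hq' =>
    Submodule.apply_mem_map₂ (TensorProduct.mk k H H) hx (hF hq' hy)
  rcases Nat.eq_zero_or_pos p with rfl | hp
  · exact Submodule.mem_sup_left (key n (by omega))
  · refine Submodule.mem_sup_right (Submodule.mem_iSup_of_mem p (Submodule.mem_iSup_of_mem (n - p)
      (Submodule.mem_iSup_of_mem ⟨?_, hp, ?_⟩ (key _ ?_)))) <;> omega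

theorem comulFiltration_le {n : ℕ} {W : Submodule k (H ⊗[k] H)}
    (h : ∀ p q x y, p + q = n → (p = 0 ∨ 0 < q) → x ∈ F p → y ∈ F q → x ⊗ₜ[k] y ∈ W) :
    comulFiltration F n ≤ W := by
  refine sup_le (Submodule.map₂_le.2 fun x hx y hy => ?_)
    (iSup_le fun p => iSup_le fun q => iSup_le fun hpq =>
      Submodule.map₂_le.2 fun x hx y hy => ?_)
  · exact h 0 n x y (by omega) (by omega) hx hy
  · exact h p q x y (by omega) (by omega) hx hy

theorem comulFiltration_mono (hF : Monotone F) : Monotone (comulFiltration F) :=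
  fun _ _ hnn' => comulFiltration_le fun _ _ _ _ hpq h hx hy =>
    tmul_mem_comulFiltration hF hx hy (by omega) h

theorem map_mem_comulFiltration {H' : Type*} [AddCommGroup H'] [Module k H']
    {F' : ℕ → Submodule k H'} (hF' : Monotone F') {f : H →ₗ[k] H'}
    (hf : ∀ n x, x ∈ F n → f x ∈ F' n) {n : ℕ} {z : H ⊗[k] H} (hz : z ∈ comulFiltration F n) :
    TensorProduct.map f f z ∈ comulFiltration F' n := by
  suffices comulFiltration F n ≤ (comulFiltration F' n).comap (TensorProduct.map f f) from this hz
  refine comulFiltration_le fun p q x y hpq h hx hy => ?_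
  rw [Submodule.mem_comap, TensorProduct.map_tmul]
  exact tmul_mem_comulFiltration hF' (hf _ _ hx) (hf _ _ hy) hpq.le h

theorem lTensor_mem_comulFiltration (hF : Monotone F) {P : H →ₗ[k] H}
    (hP : ∀ n x, x ∈ F n → P x ∈ F (n + 1)) {n : ℕ} {z : H ⊗[k] H}
    (hz : z ∈ comulFiltration F n) : P.lTensor H z ∈ comulFiltration F (n + 1) := by
  suffices comulFiltration F n ≤ (comulFiltration F (n + 1)).comap (P.lTensor H) from this hz
  refine comulFiltration_le fun p q x y hpq h hx hy => ?_
  rw [Submodule.mem_comap, LinearMap.lTensor_tmul]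
  exact tmul_mem_comulFiltration hF hx (hP _ _ hy) (by omega) (by omega)

theorem tensorMul_mem_comulFiltration (hF : Monotone F) {m : H →ₗ[k] H →ₗ[k] H}
    (hm : ∀ p q x y, x ∈ F p → y ∈ F q → m x y ∈ F (p + q)) {n n' : ℕ} {z w : H ⊗[k] H}
    (hz : z ∈ comulFiltration F n) (hw : w ∈ comulFiltration F n') :
    tensorMul m z w ∈ comulFiltration F (n + n') := by
  suffices comulFiltration F n ≤ (comulFiltration F (n + n')).comap ((tensorMul m).flip w) from
    this hz
  refine comulFiltration_le fun p q x y hpq h hx hy => ?_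
  rw [Submodule.mem_comap, LinearMap.flip_apply]
  suffices comulFiltration F n' ≤
    (comulFiltration F (n + n')).comap (tensorMul m (x ⊗ₜ[k] y)) from this hw
  refine comulFiltration_le fun p' q' x' y' hpq' h' hx' hy' => ?_
  rw [Submodule.mem_comap, tensorMul, TensorProduct.map₂_apply_tmul, TensorProduct.map_tmul]
  exact tmul_mem_comulFiltration hF (hm _ _ _ _ hx hx') (hm _ _ _ _ hy hy') (by omega) (by omega)

end TensorFiltration

/-! ### The degree filtration of `Ш(A)` -/

section Filtration

variable {k A : Type*} [CommRing k] [CommRing A] [Algebra k A] {F : ℕ → Submodule k A}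

local notation "ι" => TensorAlgebra.ι k (M := A)
local notation "𝕋" => TensorAlgebra k A

theorem deg_le {n : ℕ} {a : A} (ha : a ∈ F n) : deg F a ≤ n := Nat.sInf_le ha

theorem mem_deg (hF : ∀ a, ∃ n, a ∈ F n) (a : A) : a ∈ F (deg F a) :=
  Nat.sInf_mem (s := {n | a ∈ F n}) (hF a)

/-- The weight of the pure tensor `a₁ ⊗ ⋯ ⊗ aₘ` as a tail of pure tensors in `Ш(A)`. -/
def tailWeight (F : ℕ → Submodule k A) (l : List A) : ℕ := (l.map (deg F)).sum + l.length

theorem tailWeight_nil : tailWeight F [] = 0 := rfl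

theorem tailWeight_cons (a : A) (l : List A) :
    tailWeight F (a :: l) = deg F a + tailWeight F l + 1 := by
  simp [tailWeight]; omega

/-- The filtration of `⨁_{n ≥ 0} A^{⊗ n}` by weights of pure tensors. -/
def tailFiltration (F : ℕ → Submodule k A) (n : ℕ) : Submodule k 𝕋 :=
  Submodule.span k {z | ∃ l : List A, tailWeight F l ≤ n ∧ z = (l.map ι).prod}

theorem prod_mem_tailFiltration {l : List A} {n : ℕ} (h : tailWeight F l ≤ n) :
    (l.map ι).prod ∈ tailFiltration F n :=
  Submodule.subset_span ⟨l, h, rfl⟩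

theorem one_mem_tailFiltration (n : ℕ) : (1 : 𝕋) ∈ tailFiltration F n :=
  prod_mem_tailFiltration (l := []) (Nat.zero_le n)

theorem tailFiltration_mono : Monotone (tailFiltration F) :=
  fun _ _ h => Submodule.span_mono fun _ ⟨l, hl, hz⟩ => ⟨l, hl.trans h, hz⟩

theorem ι_mul_mem_tailFiltration {p q n : ℕ} {a : A} {x : 𝕋} (ha : a ∈ F p)
    (hx : x ∈ tailFiltration F q) (hn : p + q + 1 ≤ n) : ι a * x ∈ tailFiltration F n := by
  suffices tailFiltration F q ≤ (tailFiltration F n).comap (LinearMap.mulLeft k (ι a)) from this hx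
  refine Submodule.span_le.2 ?_
  rintro _ ⟨l, hl, rfl⟩
  refine Submodule.subset_span ⟨a :: l, ?_, by simp⟩
  have := deg_le ha
  rw [tailWeight_cons]; omega

theorem exists_mem_tailFiltration (hF : ∀ a, ∃ n, a ∈ F n) (x : 𝕋) :
    ∃ n, x ∈ tailFiltration F n := by
  induction x using cons_induction with
  | h1 => exact ⟨0, one_mem_tailFiltration 0⟩
  | hc a x hx =>
    obtain ⟨n, hn⟩ := hx
    exact ⟨_, ι_mul_mem_tailFiltration (mem_deg hF a) hn le_rfl⟩
  | hadd x y hx hy =>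
    obtain ⟨n, hn⟩ := hx
    obtain ⟨p, hp⟩ := hy
    exact ⟨max n p, add_mem (tailFiltration_mono (le_max_left n p) hn)
      (tailFiltration_mono (le_max_right n p) hp)⟩
  | hsmul c x hx =>
    obtain ⟨n, hn⟩ := hx
    exact ⟨n, Submodule.smul_mem _ c hn⟩

theorem tdWeight_mem_tailFiltration (lam : k) (h1 : (1 : A) ∈ F 0) {n : ℕ} {x : 𝕋}
    (hx : x ∈ tailFiltration F n) : tdWeight lam x ∈ tailFiltration F (n + 1) := by
  rw [tdWeight_apply]
  exact sub_mem (Submodule.smul_mem _ _ (one_mem_tailFiltration _))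
    (ι_mul_mem_tailFiltration h1 hx (by omega))

/-- Contracting `a` and `b` loses one letter, hence one unit of weight; the letter `1_A`, of degree
`0`, that `tdWeight` may insert uses up exactly this unit. -/
theorem tdShuffle_prod_mem_tailFiltration (lam : k) (hF : ∀ a, ∃ n, a ∈ F n)
    (h1 : (1 : A) ∈ F 0) (hmul : ∀ p q x y, x ∈ F p → y ∈ F q → x * y ∈ F (p + q))
    (l l' : List A) : tdShuffle lam (l.map ι).prod (l'.map ι).prod ∈
      tailFiltration F (tailWeight F l + tailWeight F l') := by
  induction l generalizing l' with
  | nil =>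
    rw [List.map_nil, List.prod_nil, tdShuffle_one_left]
    exact prod_mem_tailFiltration (by rw [tailWeight_nil]; omega)
  | cons a l hl =>
    induction l' with
    | nil =>
      rw [List.map_nil, List.prod_nil, tdShuffle_one_right]
      exact prod_mem_tailFiltration (by rw [tailWeight_nil]; omega)
    | cons b l' hl' =>
      have hb := hl (b :: l')
      simp only [List.map_cons, List.prod_cons, tailWeight_cons] at hl' hb ⊢
      rw [tdShuffle_cons_cons]
      refine add_mem (add_mem ?_ ?_) ?_
      · exact ι_mul_mem_tailFiltration (mem_deg hF a) hb (by omega)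
      · exact ι_mul_mem_tailFiltration (mem_deg hF b) hl' (by omega)
      · exact ι_mul_mem_tailFiltration (hmul _ _ _ _ (mem_deg hF a) (mem_deg hF b))
          (tdWeight_mem_tailFiltration lam h1 (hl l')) (by omega)

theorem tmul_mem_shaFiltration {p q n : ℕ} {a : A} {x : 𝕋} (ha : a ∈ F p)
    (hx : x ∈ tailFiltration F q) (hn : p + q ≤ n) : a ⊗ₜ[k] x ∈ shaFiltration F n := by
  suffices tailFiltration F q ≤ (shaFiltration F n).comap (TensorProduct.mk k A 𝕋 a) from this hx
  refine Submodule.span_le.2 ?_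
  rintro _ ⟨l, hl, rfl⟩
  refine Submodule.subset_span ⟨a, l, ?_, rfl⟩
  have := deg_le ha
  rw [tailWeight] at hl
  omega

theorem shaFiltration_le {n : ℕ} {W : Submodule k (Sha k A)}
    (h : ∀ a l, deg F a + tailWeight F l ≤ n → a ⊗ₜ[k] (l.map ι).prod ∈ W) :
    shaFiltration F n ≤ W := by
  refine Submodule.span_le.2 ?_
  rintro _ ⟨a, l, hl, rfl⟩
  exact h a l (by rw [tailWeight]; omega)

theorem shaFiltration_mono : Monotone (shaFiltration F) :=
  fun _ _ h => Submodule.span_mono fun _ ⟨a, l, hl, hz⟩ => ⟨a, l, hl.trans h, hz⟩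

theorem exists_mem_shaFiltration (hF : ∀ a, ∃ n, a ∈ F n) (x : Sha k A) :
    ∃ n, x ∈ shaFiltration F n := by
  induction x using TensorProduct.induction_on with
  | zero => exact ⟨0, zero_mem _⟩
  | tmul a x =>
    obtain ⟨n, hn⟩ := exists_mem_tailFiltration hF x
    exact ⟨_, tmul_mem_shaFiltration (mem_deg hF a) hn le_rfl⟩
  | add x y hx hy =>
    obtain ⟨n, hn⟩ := hx
    obtain ⟨p, hp⟩ := hy
    exact ⟨max n p, add_mem (shaFiltration_mono (le_max_left n p) hn)
      (shaFiltration_mono (le_max_right n p) hp)⟩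

theorem shaMul_mem_shaFiltration (lam : k) (hF : ∀ a, ∃ n, a ∈ F n)
    (h1 : (1 : A) ∈ F 0) (hmul : ∀ p q x y, x ∈ F p → y ∈ F q → x * y ∈ F (p + q))
    (p q : ℕ) (x y : Sha k A) (hx : x ∈ shaFiltration F p) (hy : y ∈ shaFiltration F q) :
    shaMul lam x y ∈ shaFiltration F (p + q) := by
  suffices shaFiltration F p ≤ (shaFiltration F (p + q)).comap ((shaMul lam).flip y) from this hx
  refine shaFiltration_le fun a l hl => ?_
  rw [Submodule.mem_comap, LinearMap.flip_apply]
  suffices shaFiltration F q ≤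
    (shaFiltration F (p + q)).comap (shaMul lam (a ⊗ₜ (l.map ι).prod)) from this hy
  refine shaFiltration_le fun b l' hl' => ?_
  rw [Submodule.mem_comap, shaMul_tmul]
  exact tmul_mem_shaFiltration (hmul _ _ _ _ (mem_deg hF a) (mem_deg hF b))
    (tdShuffle_prod_mem_tailFiltration lam hF h1 hmul l l') (by omega)

theorem shaP_mem_shaFiltration (h1 : (1 : A) ∈ F 0) (n : ℕ) (x : Sha k A)
    (hx : x ∈ shaFiltration F n) : shaP x ∈ shaFiltration F (n + 1) := by
  suffices shaFiltration F n ≤ (shaFiltration F (n + 1)).comap shaP from this hx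
  refine shaFiltration_le fun a l hl => ?_
  rw [Submodule.mem_comap, shaP_tmul, ← List.prod_cons, ← List.map_cons]
  exact tmul_mem_shaFiltration h1 (prod_mem_tailFiltration le_rfl)
    (by rw [tailWeight_cons]; omega)

theorem shaIncl_mem_shaFiltration (n : ℕ) (a : A) (ha : a ∈ F n) :
    shaIncl a ∈ shaFiltration F n :=
  tmul_mem_shaFiltration ha (one_mem_tailFiltration 0) le_rfl

/-- Along the recursion for `Δ`, the factor `Δ_A(a)` accounts for `deg a`, and `id ⊗ P` for the
extra unit that each tail letter carries. -/
theorem shaComul_tmul_prod_mem (lam : k) {ΔA : A →ₗ[k] A ⊗[k] A}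
    (hF : IsConnectedFiltration (LinearMap.mul k A) 1 ΔA F) (a : A) (l : List A) :
    shaComul lam ΔA (a ⊗ₜ (l.map ι).prod) ∈
      comulFiltration (shaFiltration F) (deg F a + tailWeight F l) := by
  have h1 : (1 : A) ∈ F 0 := hF.connected ▸ Submodule.mem_span_singleton_self 1
  have hA : ∀ a, TensorProduct.map shaIncl shaIncl (ΔA a) ∈
      comulFiltration (shaFiltration F) (deg F a) := fun a =>
    map_mem_comulFiltration shaFiltration_mono shaIncl_mem_shaFiltration
      (hF.comul_mem _ a (mem_deg hF.exhaustive a))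
  induction l generalizing a with
  | nil =>
    rw [List.map_nil, List.prod_nil, shaComul_incl]
    exact hA a
  | cons b l hl =>
    rw [List.map_cons, List.prod_cons, shaComul_cons, tailWeight_cons]
    exact tensorMul_mem_comulFiltration shaFiltration_mono
      (shaMul_mem_shaFiltration lam hF.exhaustive h1 hF.mul_mem) (hA a)
      (lTensor_mem_comulFiltration shaFiltration_mono (shaP_mem_shaFiltration h1) (hl b))

theorem shaFiltration_zero (hF : ∀ a, ∃ n, a ∈ F n) (h0 : F 0 = Submodule.span k {1}) :
    shaFiltration F 0 = Submodule.span k {shaOne} := by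
  refine le_antisymm (shaFiltration_le fun a l hl => ?_) ?_
  · have hl0 : l = [] := by
      rw [tailWeight] at hl
      exact List.length_eq_zero_iff.1 (by omega)
    have ha := mem_deg hF a
    rw [show deg F a = 0 by omega, h0] at ha
    obtain ⟨c, rfl⟩ := Submodule.mem_span_singleton.1 ha
    rw [hl0]
    exact Submodule.mem_span_singleton.2 ⟨c, (TensorProduct.smul_tmul' c _ _)⟩
  · rw [Submodule.span_singleton_le_iff_mem]
    exact shaIncl_mem_shaFiltration 0 1 (h0 ▸ Submodule.mem_span_singleton_self 1)

theorem isConnectedFiltration_sha (lam : k) {ΔA : A →ₗ[k] A ⊗[k] A}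
    (hF : IsConnectedFiltration (LinearMap.mul k A) 1 ΔA F) :
    IsConnectedFiltration (shaMul lam) shaOne (shaComul lam ΔA) (shaFiltration F) where
  mono := shaFiltration_mono
  exhaustive := exists_mem_shaFiltration hF.exhaustive
  mul_mem := shaMul_mem_shaFiltration lam hF.exhaustive
    (hF.connected ▸ Submodule.mem_span_singleton_self 1) hF.mul_mem
  comul_mem n x hx := by
    suffices shaFiltration F n ≤
      (comulFiltration (shaFiltration F) n).comap (shaComul lam ΔA) from this hx
    exact shaFiltration_le fun a l hl =>
      comulFiltration_mono shaFiltration_mono hl (shaComul_tmul_prod_mem lam hF a l)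
  connected := shaFiltration_zero hF.exhaustive hF.connected

end Filtration

/-! ### Right antipodes of connected filtered left counital bialgebras -/

section Antipode

variable {k H : Type*} [CommRing k] [AddCommGroup H] [Module k H]
  {m : H →ₗ[k] H →ₗ[k] H} {one : H} {Δ : H →ₗ[k] H ⊗[k] H} {ε : H →ₗ[k] k}
  {F : ℕ → Submodule k H}

/-- Left convolution by the identity: `g ↦ id * g = m (id ⊗ g) Δ`. -/
def idConv (m : H →ₗ[k] H →ₗ[k] H) (Δ : H →ₗ[k] H ⊗[k] H) : Module.End k (H →ₗ[k] H) :=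
  LinearMap.lcomp k H Δ ∘ₗ LinearMap.llcomp k (H ⊗[k] H) (H ⊗[k] H) H (TensorProduct.lift m) ∘ₗ
    LinearMap.lTensorHom H

theorem idConv_apply (g : H →ₗ[k] H) (x : H) :
    idConv m Δ g x = TensorProduct.lift m (g.lTensor H (Δ x)) := rfl

/-- The previous step `H^{n-1}` of a filtration, with `H^{-1} = 0`. -/
def prevFiltration (F : ℕ → Submodule k H) : ℕ → Submodule k H
  | 0 => ⊥
  | n + 1 => F n

theorem le_prevFiltration (hF : Monotone F) {q n : ℕ} (h : q < n) : F q ≤ prevFiltration F n := by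
  obtain ⟨n, rfl⟩ : ∃ n', n = n' + 1 := ⟨n - 1, by omega⟩
  exact hF (by omega)

/-- In a connected filtered left counital bialgebra, `Δ x - 1 ⊗ x ∈ H ⊗ H^{n-1}` for `x ∈ Hⁿ`. -/
theorem comul_sub_one_tmul_mem (hB : IsLeftCounitalBialgebra m one Δ ε)
    (hF : IsConnectedFiltration m one Δ F) {n : ℕ} {x : H} (hx : x ∈ F n) :
    Δ x - one ⊗ₜ x ∈ tensorSub ⊤ (prevFiltration F n) := by
  have hle : comulFiltration F n ≤
      LinearMap.range (TensorProduct.mk k H H one) ⊔ tensorSub ⊤ (prevFiltration F n) := by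
    refine comulFiltration_le fun p q x y hpq h hx hy => ?_
    rcases Nat.eq_zero_or_pos p with rfl | hp
    · rw [hF.connected] at hx
      obtain ⟨c, rfl⟩ := Submodule.mem_span_singleton.1 hx
      exact Submodule.mem_sup_left ⟨c • y, (TensorProduct.smul_tmul c one y).symm⟩
    · exact Submodule.mem_sup_right (Submodule.apply_mem_map₂ (TensorProduct.mk k H H)
        Submodule.mem_top (le_prevFiltration hF.mono (by omega) hy))
  -- Here `Δ x = 1 ⊗ y + z` with `z ∈ H ⊗ H^{n-1}`. The left counit gives `x = y + (ε ⊗ id) z`, so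
  -- replacing `y` by `x` changes `Δ x` only inside `H ⊗ H^{n-1}`.
  obtain ⟨_, ⟨y, rfl⟩, z, hz, hyz⟩ := Submodule.mem_sup.1 (hle (hF.comul_mem n x hx))
  have hz' : TensorProduct.lid k H (ε.rTensor H z) ∈ prevFiltration F n := by
    suffices tensorSub ⊤ (prevFiltration F n) ≤ (prevFiltration F n).comap
      ((TensorProduct.lid k H).toLinearMap ∘ₗ ε.rTensor H) from this hz
    refine Submodule.map₂_le.2 fun u _ v hv => ?_
    simpa using Submodule.smul_mem _ (ε u) hv
  have hxy : x = y + TensorProduct.lid k H (ε.rTensor H z) := by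
    have h := congrArg (TensorProduct.lid k H) (hB.left_counit x)
    rw [← hyz] at h
    simpa [hB.counit_one] using h.symm
  have hΔ : Δ x - one ⊗ₜ x = z - one ⊗ₜ (TensorProduct.lid k H (ε.rTensor H z)) := by
    rw [← hyz, TensorProduct.mk_apply]
    nth_rewrite 1 [hxy]
    rw [TensorProduct.tmul_add]
    abel
  rw [hΔ]
  exact sub_mem hz (Submodule.apply_mem_map₂ (TensorProduct.mk k H H) Submodule.mem_top hz')

theorem lift_lTensor_eq_zero {V : Submodule k H} {g : H →ₗ[k] H} (hg : ∀ x ∈ V, g x = 0)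
    {z : H ⊗[k] H} (hz : z ∈ tensorSub ⊤ V) : TensorProduct.lift m (g.lTensor H z) = 0 := by
  suffices tensorSub ⊤ V ≤ LinearMap.ker (TensorProduct.lift m ∘ₗ g.lTensor H) from this hz
  refine Submodule.map₂_le.2 fun u _ v hv => ?_
  simp [hg v hv]

/-- Since `g` kills `H^{n-1}`, only the term `1 ⊗ x` of `Δ x` contributes. -/
theorem idConv_eq_self (hB : IsLeftCounitalBialgebra m one Δ ε)
    (hF : IsConnectedFiltration m one Δ F) {n : ℕ} {g : H →ₗ[k] H}
    (hg : ∀ x ∈ prevFiltration F n, g x = 0) {x : H} (hx : x ∈ F n) :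
    idConv m Δ g x = g x := by
  have h := lift_lTensor_eq_zero (m := m) hg (comul_sub_one_tmul_mem hB hF hx)
  rw [map_sub, map_sub, sub_eq_zero] at h
  rw [idConv_apply, h, LinearMap.lTensor_tmul, TensorProduct.lift.tmul, hB.one_mul]

/-- Each factor `1 - L` gains one filtration step; the start is free because `H^{-1} = 0`. -/
theorem one_sub_idConv_pow_eq_zero (hB : IsLeftCounitalBialgebra m one Δ ε)
    (hF : IsConnectedFiltration m one Δ F) (e : H →ₗ[k] H) (i : ℕ) :
    ∀ x ∈ prevFiltration F i, ((1 - idConv m Δ) ^ i) e x = 0 := by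
  induction i with
  | zero =>
    intro x hx
    rw [(Submodule.mem_bot k).1 hx, map_zero]
  | succ i hi =>
    intro x hx
    rw [pow_succ', Module.End.mul_apply, LinearMap.sub_apply, Module.End.one_apply,
      LinearMap.sub_apply, idConv_eq_self hB hF hi hx, sub_self]

/-- A connected filtered left counital bialgebra has a right antipode, given by the locally finite
series `∑ᵢ (1 - L)ⁱ (one ∘ ε)` with `L` the left convolution by the identity. -/
theorem exists_isRightAntipode (hB : IsLeftCounitalBialgebra m one Δ ε)
    (hF : IsConnectedFiltration m one Δ F) : ∃ S, IsRightAntipode m one Δ ε S := by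
  set e : H →ₗ[k] H := ε.smulRight one
  set T : Module.End k (H →ₗ[k] H) := 1 - idConv m Δ with hT
  have hzero : ∀ n i x, x ∈ F n → n < i → (T ^ i) e x = 0 := fun n i x hx hni =>
    one_sub_idConv_pow_eq_zero hB hF e i x (le_prevFiltration hF.mono hni hx)
  have hsupp : ∀ n x, x ∈ F n →
      (Function.support fun i => (T ^ i) e x) ⊆ (Finset.range (n + 1) : Set ℕ) := by
    intro n x hx i hi
    by_contra h
    rw [Finset.mem_coe, Finset.mem_range] at h
    exact hi (hzero n i x hx (by omega))
  have hfin : ∀ x, (Function.support fun i => (T ^ i) e x).Finite := fun x =>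
    (Finset.finite_toSet _).subset (hsupp _ x (hF.exhaustive x).choose_spec)
  let S : H →ₗ[k] H :=
    { toFun x := ∑ᶠ i, (T ^ i) e x
      map_add' x y := by
        simp only [map_add]
        exact finsum_add_distrib (hfin x) (hfin y)
      map_smul' c x := by
        simp only [map_smul, RingHom.id_apply]
        exact (smul_finsum' c (hfin x)).symm }
  have hS : ∀ n x, x ∈ F n → S x = (∑ i ∈ Finset.range (n + 1), (T ^ i) e) x := by
    intro n x hx
    rw [LinearMap.sum_apply]
    exact finsum_eq_sum_of_support_subset _ (hsupp n x hx)
  refine ⟨S, fun x => ?_⟩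
  obtain ⟨n, hx⟩ := hF.exhaustive x
  -- The tail of the series vanishes on `Hⁿ`, hence so does its convolution by the identity: apply
  -- `idConv_eq_self` at level `n + 1`.
  have hdiff : idConv m Δ (S - ∑ i ∈ Finset.range (n + 1), (T ^ i) e) x = 0 := by
    have hg : ∀ y ∈ F n, (S - ∑ i ∈ Finset.range (n + 1), (T ^ i) e) y = 0 := fun y hy => by
      rw [LinearMap.sub_apply, hS n y hy, sub_self]
    rw [idConv_eq_self hB hF (n := n + 1) hg (hF.mono n.le_succ hx), hg x hx]
  -- As `L = 1 - T`, the sum telescopes, and `T^{n+1} e` vanishes on `Hⁿ`.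
  have htele : idConv m Δ (∑ i ∈ Finset.range (n + 1), (T ^ i) e) = e - (T ^ (n + 1)) e := by
    have h : ∀ i, idConv m Δ ((T ^ i) e) = (T ^ i) e - (T ^ (i + 1)) e := by
      intro i
      rw [pow_succ' T i, Module.End.mul_apply, hT, LinearMap.sub_apply, Module.End.one_apply,
        sub_sub_cancel]
    rw [map_sum, Finset.sum_congr rfl fun i _ => h i, Finset.sum_range_sub']
    rfl
  rw [map_sub, LinearMap.sub_apply, sub_eq_zero, htele, LinearMap.sub_apply,
    hzero n (n + 1) x hx n.lt_succ_self, sub_zero] at hdiff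
  exact hdiff

end Antipode

end TDHopf

end

theorem mainTheorem2 {k : Type u} {A : Type v} [CommRing k] [CommRing A] [Algebra k A]
    (lam : k) (ΔA : A →ₗ[k] A ⊗[k] A) (εA : A →ₗ[k] k) (F : ℕ → Submodule k A)
    (hA : TDHopf.IsLeftCounitalBialgebra (LinearMap.mul k A) 1 ΔA εA)
    (hF : TDHopf.IsConnectedFiltration (LinearMap.mul k A) 1 ΔA F) :
    TDHopf.IsFreeCommTDAlgebra.{w} lam (TDHopf.shaMul (A := A) lam) TDHopf.shaOne TDHopf.shaP
        TDHopf.shaIncl ∧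
      TDHopf.IsCocycle (TDHopf.shaComul lam ΔA) TDHopf.shaP ∧
      TDHopf.IsConnectedFiltration (TDHopf.shaMul lam) TDHopf.shaOne (TDHopf.shaComul lam ΔA)
        (TDHopf.shaFiltration F) ∧
      TDHopf.IsLeftCounitalHopfAlgebra (TDHopf.shaMul lam) TDHopf.shaOne
        (TDHopf.shaComul lam ΔA) (TDHopf.shaCounit εA) := by
  have hB := TDHopf.isLeftCounitalBialgebra_sha lam hA
  have hFil := TDHopf.isConnectedFiltration_sha lam hF
  exact ⟨TDHopf.isFreeCommTDAlgebra_sha lam, TDHopf.isCocycle_shaComul lam hA.comul_one, hFil, hB,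
    TDHopf.exists_isRightAntipode hB hFil⟩
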